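/- Let $L>0$ and $\Omega:=(0,L)$. Put $$\mathcal E(u,v):=\int_{\mathbb R}\int_{(x-1,x+1)}\frac{(u(x)-u(y))(v(x)-v(y))}{|x-y|}\,dy\,dx,$$ let $\mathbb H(\Omega)$ be the space of all $u\in L^2(\mathbb R)$ with $u=0$ on $\mathbb R\setminus\Omega$ and $\|u\|_{\mathbb H(\Omega)}:=\mathcal E(u,u)^{1/2}<\infty$, and for $u,v\in\mathbb H(\Omega)$ let $$\mathcal E_L(u,v):=\mathcal E(u,v)-\iint_{|x-y|\ge 1}\frac{u(x)v(y)}{|x-y|}\,dx\,dy+\rho_1\int_{\mathbb R}uv\,dx,\qquad \rho_1:=2\ln 2+\psi(\tfrac12)-\gamma,$$ where $\psi=\Gamma'/\Gamma$ and $\gamma$ is the Euler–Mascheroni constant. For $f\in L^2(\Omega)$, a weak solution of $L_\Delta u=f$ in $\Omega$, $u=0$ in $\mathbb R\setminus\Omega$ ($L_\Delta$ being the logarithmic Laplacian) is a function $u\in\mathbb H(\Omega)$ with $\mathcal E_L(u,v)=\int_\Omega fv\,dx$ for all $v\in\mathbb H(\Omega)$. For an integer $N\ge 0$ let $h:=L/(N+1)$,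 $\Omega_i:=(ih,(i+1)h)$ for $i=0,\dots,N$, and let $\mathcal V_h$ be either one of the two finite element spaces $$\{v\in C^0(\Omega): v=0 \text{ in }\mathbb R\setminus\Omega,\ v|_{\Omega_i}\in\mathcal P_1\ (0\le i\le N)\},\qquad \{v\in C^0(\mathbb R): v=0 \text{ in }\mathbb R\setminus\Omega,\ v|_{\Omega_i}\in\mathcal P_1\ (0\le i\le N)\},$$ where $\mathcal P_1$ is the set of polynomials of degree at most one (in the first space $v:\mathbb R\to\mathbb R$ is continuous in the open interval $\Omega$ and may jump at its end points). Assume that the only weak solution of $L_\Delta u=0$ in $\Omega$, $u=0$ in $\mathbb R\setminus\Omega$, is $u=0$. Then there are constants $h_0>0$, $\alpha_0>0$ and $C>0$, depending only on $L$ and in particular independent of $h$, such that for all $h=L/(N+1)\in(0,h_0)$ and both choices of $\mathcal V_h$: 1. (discrete inf-sup condition) $$\sup_{v_h\in\mathcal V_h\setminus\{0\}}\frac{\mathcal E_L(u_h,v_h)}{\|v_h\|_{\mathbb H(\Omega)}}\ \ge\ \alpha_0\,\|u_h\|_{\mathbb H(\Omega)}\qquad\text{for all }u_h\in\mathcal V_h,$$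 the supremum being finite; 2. (quasi-optimality) for every $f\in L^2(\Omega)$ there is exactly one $u_h\in\mathcal V_h$ with $\mathcal E_L(u_h,v)=\int_\Omega fv\,dx$ for all $v\in\mathcal V_h$, and every weak solution $u$ of $L_\Delta u=f$ in $\Omega$, $u=0$ in $\mathbb R\setminus\Omega$, satisfies $$\|u-u_h\|_{\mathbb H(\Omega)}\le C\inf_{w_h\in\mathcal V_h}\|u-w_h\|_{\mathbb H(\Omega)}.$$ -/

import Mathlib

open MeasureTheory Set

noncomputable section

namespace LogLaplacian

/-- The constant `ρ₁ = 2 ln 2 + ψ(1/2) - γ`, with `ψ = Γ'/Γ` the digamma function and `γ` the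
Euler-Mascheroni constant. -/
def rho₁ : ℝ :=
  2 * Real.log 2 + deriv Real.Gamma (1 / 2) / Real.Gamma (1 / 2) - Real.eulerMascheroniConstant

/-- The form `ℰ(u,v) = ∫_ℝ ∫_{B₁(x)} (u(x)-u(y)) (v(x)-v(y)) / |x-y| dy dx`. On the diagonal the
integrand is `0 / 0 = 0`, which concerns a null set only. -/
def formE (u v : ℝ → ℝ) : ℝ :=
  ∫ x, ∫ y in Metric.ball x 1, (u x - u y) * (v x - v y) / |x - y|

/-- `ℍ(Ω)` for `Ω = (0, L)`: functions on `ℝ` that are square integrable, vanish outside `Ω`, and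
have finite energy `ℰ(u,u)`. Elements are functions, not classes; equality in `ℍ(Ω)` is equality
almost everywhere. -/
structure MemH (L : ℝ) (u : ℝ → ℝ) : Prop where
  memLp : MemLp u 2 volume
  eq_zero : ∀ x, x ∉ Ioo 0 L → u x = 0
  energy_lt_top :
    ∫⁻ x, ∫⁻ y in Metric.ball x 1, ENNReal.ofReal ((u x - u y) ^ 2 / |x - y|) < ⊤

/-- The norm of `ℍ(Ω)`, `‖u‖² = ℰ(u,u)`. -/
def normH (u : ℝ → ℝ) : ℝ := Real.sqrt (formE u u)

/-- `B(u,v) = -∬_{|x-y| ≥ 1} u(x) v(y) / |x-y| dx dy + ρ₁ ∫_ℝ u v dx`. -/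
def formB (u v : ℝ → ℝ) : ℝ :=
  -(∫ p in {p : ℝ × ℝ | 1 ≤ |p.1 - p.2|}, u p.1 * v p.2 / |p.1 - p.2|)
    + rho₁ * ∫ x, u x * v x

/-- The bilinear form `ℰ_L = ℰ + B` of the logarithmic Laplacian (the `L` in the name stands for
the operator). -/
def formEL (u v : ℝ → ℝ) : ℝ := formE u v + formB u v

/-- `u` is a weak solution of `L_Δ u = f` in `Ω = (0, L)`, `u = 0` in `ℝ \ Ω`. -/
def IsWeakSolution (L : ℝ) (f u : ℝ → ℝ) : Prop :=
  MemH L u ∧ ∀ v, MemH L v → formEL u v = ∫ x in Ioo 0 L, f x * v x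

/-- The mesh size `h = L / (N + 1)`. -/
def meshSize (L : ℝ) (N : ℕ) : ℝ := L / (N + 1)

/-- `v` is affine on every open cell `Ω_i = (i h, (i+1) h)`, `i = 0, …, N`. -/
def IsPiecewiseAffine (L : ℝ) (N : ℕ) (v : ℝ → ℝ) : Prop :=
  ∀ i : ℕ, i ≤ N → ∃ a b : ℝ,
    ∀ x ∈ Ioo (i * meshSize L N) ((i + 1) * meshSize L N), v x = a * x + b

/-- The finite element space `{v ∈ C⁰(Ω) : v = 0 in ℝ \ Ω, v|_{Ω_i} ∈ P₁}`. Continuity is required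
in the open interval only, so a jump at the two end points is possible: this is the span of all
`N + 2` shape functions, including the two discontinuous ones at the ends. -/
def feSpace (L : ℝ) (N : ℕ) : Set (ℝ → ℝ) :=
  {v | ContinuousOn v (Ioo 0 L) ∧ (∀ x, x ∉ Ioo 0 L → v x = 0) ∧ IsPiecewiseAffine L N v}

/-- The variant `{v ∈ C⁰(ℝ) : v = 0 in ℝ \ Ω, v|_{Ω_i} ∈ P₁}`, continuous on the whole line: the
span of the `N` interior hat functions. -/
def feSpaceCont (L : ℝ) (N : ℕ) : Set (ℝ → ℝ) :=
  {v | Continuous v ∧ (∀ x, x ∉ Ioo 0 L → v x = 0) ∧ IsPiecewiseAffine L N v}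

/-- The discrete inf-sup condition with constant `α` on the space `V`: for all `u ∈ V`,
`sup_{v ∈ V, v ≠ 0} ℰ_L(u,v) / ‖v‖ ≥ α ‖u‖`, where the supremum is a genuine (finite) one. -/
def DiscreteInfSup (V : Set (ℝ → ℝ)) (α : ℝ) : Prop :=
  ∀ u ∈ V, ∃ s : ℝ,
    IsLUB {q : ℝ | ∃ v ∈ V, v ≠ 0 ∧ q = formEL u v / normH v} s ∧ α * normH u ≤ s

/-- `uh ∈ V` solves the discrete problem `ℰ_L(uh, v) = ∫_Ω f v` for all `v ∈ V`. -/
def IsDiscreteSolution (L : ℝ) (V : Set (ℝ → ℝ)) (f uh : ℝ → ℝ) : Prop :=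
  uh ∈ V ∧ ∀ v ∈ V, formEL uh v = ∫ x in Ioo 0 L, f x * v x

/-- Quasi-optimality of the Galerkin method on `V` with constant `C`: for every `f ∈ L²(Ω)` the
discrete problem has exactly one solution `uh`, and every weak solution `u` satisfies
`‖u - uh‖ ≤ C inf_{w ∈ V} ‖u - w‖`. -/
def QuasiOptimal (L : ℝ) (V : Set (ℝ → ℝ)) (C : ℝ) : Prop :=
  ∀ f : ℝ → ℝ, MemLp f 2 (volume.restrict (Ioo 0 L)) →
    ∃ uh, IsDiscreteSolution L V f uh ∧ (∀ wh, IsDiscreteSolution L V f wh → wh = uh) ∧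
      ∀ u, IsWeakSolution L f u → normH (u - uh) ≤ C * ⨅ w : V, normH (u - (w : ℝ → ℝ))

end LogLaplacian

end

open Filter Topology
open scoped ENNReal NNReal InnerProductSpace

/-! Give `ℍ(Ω)` the graph inner product `∫ u v + ℰ(u,v)`. It becomes a Hilbert space of classes on
which `ℰ_L(u,v) = ⟨u + K u, v⟩`, where `K = ι* ((ρ₁ - 1) - T) ι`, `ι` is the embedding into `L²(Ω)`
and `T` is the bounded far-field operator (`formEL_eq`). A Poincaré inequality (`exists_poincare`)
makes the graph norm equivalent to `normH`.

The embedding `ι` is compact (`isCompactOperator_embedding`) because `1/|t|` is not integrable at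
`0`, if only logarithmically. Hence `K` is compact, and uniqueness of the weak solution says that `1
+ K` is injective. For such operators Galerkin projections are stable as soon as the discrete spaces
exhaust `ℍ(Ω)` (`exists_uniform_lower_bound`): unit vectors violating the bound would have a
subsequence converging to a unit vector in the kernel of `1 + K`. The bound holds for every space
containing the conforming one, so both finite element spaces are covered at once.

Exhaustion reduces to Lipschitz functions, whose interpolants converge in energy
(`mem_approximable_of_lipschitz`). Density of Lipschitz functions (`mem_of_lipschitz_mem`) comes
from truncation, cutoff at the left end and averaging. Convergence in energy is never needed there:
bounded energy with `L²` convergence gives weak convergence, and closed subspaces are weakly closed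
(`mem_of_bounded_of_tendsto`).

The inf-sup condition follows by testing with the projection of `u + K u`, and quasi-optimality by
Céa's argument. -/

namespace LogLaplacian

variable {L : ℝ}

/-! ### Hilbert space lemmas: Galerkin stability, weak closedness, compactness by approximation -/

section Abstract

variable {H X : Type*} [NormedAddCommGroup H] [InnerProductSpace ℝ H]
  [NormedAddCommGroup X] [InnerProductSpace ℝ X]

theorem norm_sub_starProjection_le (V : Submodule ℝ H) [V.HasOrthogonalProjection] (x : H)
    {w : H} (hw : w ∈ V) : ‖x - V.starProjection x‖ ≤ ‖x - w‖ := by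
  rw [V.starProjection_minimal x]
  exact ciInf_le ⟨0, by rintro _ ⟨y, rfl⟩; positivity⟩ (⟨w, hw⟩ : V)

/-- Stability of Galerkin projections of an injective compact perturbation of the identity. -/
theorem exists_uniform_lower_bound {K : H →L[ℝ] H} (hK : IsCompactOperator K)
    (hinj : ∀ x, x + K x = 0 → x = 0) (W : ℕ → Submodule ℝ H)
    (hW : ∀ x, ∀ ε > 0, ∃ N₀, ∀ N ≥ N₀, ∃ w ∈ W N, ‖x - w‖ ≤ ε) :
    ∃ N₀ : ℕ, ∃ α > (0 : ℝ), ∀ N ≥ N₀, ∀ V : Submodule ℝ H, W N ≤ V →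
      ∀ [V.HasOrthogonalProjection], ∀ u ∈ V, α * ‖u‖ ≤ ‖V.starProjection (u + K u)‖ := by
  by_contra! hcon
  have hex : ∀ k : ℕ, ∃ N ≥ k, ∃ V : Submodule ℝ H, W N ≤ V ∧ ∃ _ : V.HasOrthogonalProjection,
      ∃ u ∈ V, ‖u‖ = 1 ∧ ‖V.starProjection (u + K u)‖ ≤ 1 / ((k : ℝ) + 1) := by
    intro k
    obtain ⟨N, hN, V, hV, inst, u, hu, hlt⟩ := hcon k (1 / ((k : ℝ) + 1)) (by positivity)
    have hu0 : u ≠ 0 := by rintro rfl; simp at hlt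
    have hn : 0 < ‖u‖ := norm_pos_iff.2 hu0
    refine ⟨N, hN, V, hV, inst, ‖u‖⁻¹ • u, V.smul_mem _ hu, ?_, ?_⟩
    · rw [norm_smul, norm_inv, norm_norm, inv_mul_cancel₀ hn.ne']
    · rw [map_smul, ← smul_add, map_smul, norm_smul, norm_inv, norm_norm,
        inv_mul_le_iff₀ hn, mul_comm]
      exact hlt.le
  choose N hN V hV inst u hu hu1 hPu using hex
  -- Since `N k ≥ k` and `W (N k) ≤ V k`, the best approximation error in `V k` tends to zero.
  have hproj : ∀ x, Tendsto (fun k => (V k).starProjection x) atTop (𝓝 x) := by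
    intro x
    rw [Metric.tendsto_atTop]
    intro ε hε
    obtain ⟨N₀, h0⟩ := hW x (ε / 2) (half_pos hε)
    refine ⟨N₀, fun k hk => ?_⟩
    obtain ⟨w, hw, hxw⟩ := h0 (N k) (hk.trans (hN k))
    rw [dist_comm, dist_eq_norm]
    have := norm_sub_starProjection_le (V k) x (hV k hw)
    linarith
  have hcpt := hK.image_closedBall_subset_compact (f := (K : H →ₗ[ℝ] H)) 1
  obtain ⟨S, hS, hKS⟩ := hcpt
  obtain ⟨w, -, φ, hφ, hlim⟩ := hS.tendsto_subseq
    (fun k => hKS ⟨u k, by simp [hu1 k], rfl⟩)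
  have hlim' : Tendsto (fun k => K (u (φ k))) atTop (𝓝 w) := hlim
  have hPK : Tendsto (fun k => (V (φ k)).starProjection (K (u (φ k)))) atTop (𝓝 w) := by
    have h1 : Tendsto (fun k => (V (φ k)).starProjection (K (u (φ k)) - w)) atTop (𝓝 0) := by
      refine squeeze_zero_norm (fun k => (V (φ k)).norm_starProjection_apply_le _) ?_
      simpa using (hlim'.sub_const w).norm
    have h2 := h1.add ((hproj w).comp hφ.tendsto_atTop)
    simpa using h2
  have hP0 : Tendsto (fun k => (V (φ k)).starProjection (u (φ k) + K (u (φ k)))) atTop (𝓝 0) :=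
    squeeze_zero_norm (fun k => hPu _)
      (tendsto_one_div_add_atTop_nhds_zero_nat.comp hφ.tendsto_atTop)
  -- The projection fixes `u (φ k)`, so subtracting the two limits upgrades compactness of `K` to
  -- norm convergence of `u (φ k)` itself.
  have hul : Tendsto (fun k => u (φ k)) atTop (𝓝 (-w)) := by
    have h3 := hP0.sub hPK
    simp only [map_add, zero_sub, add_sub_cancel_right] at h3
    refine h3.congr fun k => ?_
    exact Submodule.starProjection_eq_self_iff.2 (hu _)
  have hw1 : ‖-w‖ = 1 := tendsto_nhds_unique hul.norm (by simp [hu1])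
  have hKw : K (-w) = w := tendsto_nhds_unique ((K.continuous.tendsto _).comp hul) hlim'
  have := hinj (-w) (by rw [hKw]; simp)
  rw [this] at hw1
  simp at hw1

/-- A bounded sequence of a closed subspace which converges in a larger space to the image of a
vector converges weakly to it, so that the vector lies in the subspace. -/
theorem mem_of_bounded_of_tendsto [CompleteSpace H] [CompleteSpace X] {ι : H →L[ℝ] X}
    (hι : Function.Injective ι) (D : Submodule ℝ H) (hD : IsClosed (D : Set H)) {u : ℕ → H}
    (hu : ∀ n, u n ∈ D) {C : ℝ} (hC : ∀ n, ‖u n‖ ≤ C) {x : H}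
    (hx : Tendsto (fun n => ι (u n)) atTop (𝓝 (ι x))) : x ∈ D := by
  have : CompleteSpace D := hD.completeSpace_coe
  rw [← D.orthogonal_orthogonal, Submodule.mem_orthogonal']
  intro z hz
  -- Injectivity of `ι` is density of the range of its adjoint. Against `ι* a` the pairing is one in
  -- `X`, where convergence is assumed; the bound `C` then passes from this range to every `z`.
  have hdense : z ∈ (LinearMap.range (ContinuousLinearMap.adjoint ι).toLinearMap).topologicalClosure := by
    rw [← Submodule.orthogonal_orthogonal_eq_closure, Submodule.mem_orthogonal]
    intro y hy
    have : y = 0 := by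
      apply hι
      rw [map_zero]
      refine ext_inner_left ℝ fun a => ?_
      have h1 := (Submodule.mem_orthogonal _ _).1 hy (ContinuousLinearMap.adjoint ι a) ⟨a, rfl⟩
      rw [ContinuousLinearMap.adjoint_inner_left] at h1
      rw [h1, inner_zero_right]
    rw [this, inner_zero_left]
  have hlim : Tendsto (fun n => ⟪u n, z⟫_ℝ) atTop (𝓝 ⟪x, z⟫_ℝ) := by
    have hC0 : 0 ≤ C := (norm_nonneg _).trans (hC 0)
    rw [Metric.tendsto_atTop]
    intro ε hε
    set δ := ε / (2 * (C + ‖x‖ + 1)) with hδ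
    have hpos : 0 < C + ‖x‖ + 1 := by positivity
    have hδ0 : 0 < δ := by positivity
    obtain ⟨y, ⟨a, rfl⟩, hy⟩ := Metric.mem_closure_iff.1 hdense δ hδ0
    have h2 : Tendsto (fun n => ⟪ι (u n), a⟫_ℝ) atTop (𝓝 ⟪ι x, a⟫_ℝ) :=
      hx.inner tendsto_const_nhds
    obtain ⟨n₀, hn₀⟩ := Metric.tendsto_atTop.1 h2 (ε / 2) (half_pos hε)
    refine ⟨n₀, fun n hn => ?_⟩
    have h3 := hn₀ n hn
    simp only [Real.dist_eq, ← inner_sub_left] at h3 ⊢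
    rw [← map_sub, ← ContinuousLinearMap.adjoint_inner_right] at h3
    have h4 : ⟪u n - x, z⟫_ℝ = ⟪u n - x, ContinuousLinearMap.adjoint ι a⟫_ℝ
        + ⟪u n - x, z - ContinuousLinearMap.adjoint ι a⟫_ℝ := by
      rw [← inner_add_right]; simp
    have h5 : |⟪u n - x, z - ContinuousLinearMap.adjoint ι a⟫_ℝ| ≤ (C + ‖x‖) * δ := by
      refine (abs_real_inner_le_norm _ _).trans ?_
      gcongr
      · exact (norm_sub_le _ _).trans (by gcongr; exact hC n)
      · rw [← dist_eq_norm]; exact hy.le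
    have h6 : (C + ‖x‖) * δ < ε / 2 := by
      have : (C + ‖x‖ + 1) * δ = ε / 2 := by rw [hδ]; field_simp
      nlinarith
    rw [h4]
    calc _ ≤ _ := abs_add_le _ _
      _ < ε := by linarith
  have h0 : ∀ n, ⟪u n, z⟫_ℝ = 0 := fun n => (Submodule.mem_orthogonal _ _).1 hz _ (hu n)
  simp only [h0] at hlim
  exact (tendsto_nhds_unique hlim tendsto_const_nhds)

/-- An operator whose image of the unit ball is close to finite-dimensional subspaces is compact. -/
theorem isCompactOperator_of_approx [CompleteSpace X] (T : H →L[ℝ] X)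
    (hT : ∀ ε > 0, ∃ S : Submodule ℝ X, FiniteDimensional ℝ S ∧
      ∀ x, ∃ s ∈ S, ‖T x - s‖ ≤ ε * ‖x‖) : IsCompactOperator T := by
  have hn : ∀ n : ℕ, ∃ S : Submodule ℝ X, FiniteDimensional ℝ S ∧
      ∀ x, ∃ s ∈ S, ‖T x - s‖ ≤ (1 / ((n : ℝ) + 1)) * ‖x‖ := fun n => hT _ (by positivity)
  choose S hS hTS using hn
  -- The finite-rank operators obtained by projecting `T` onto `S n` converge to `T` in operator
  -- norm.
  refine isCompactOperator_of_tendsto (l := atTop) (F := fun n => (S n).starProjection ∘L T) ?_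
    (Eventually.of_forall fun n => ?_)
  · rw [tendsto_iff_norm_sub_tendsto_zero]
    refine squeeze_zero (fun _ => norm_nonneg _) (fun n => ?_)
      tendsto_one_div_add_atTop_nhds_zero_nat
    refine ContinuousLinearMap.opNorm_le_bound _ (by positivity) fun x => ?_
    obtain ⟨s, hs, hxs⟩ := hTS n x
    have := norm_sub_starProjection_le (S n) (T x) hs
    rw [norm_sub_rev] at this
    exact this.trans hxs
  · exact (isCompactOperator_of_locallyCompactSpace_dom
      ((S n).orthogonalProjectionOnto ∘L T)).clm_comp (S n).subtypeL

end Abstract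

/-! ### The energy as a squared `L²(ν)` norm of differences -/

/-- The kernel `1_{|t| < 1} / |t|` of the energy form. -/
noncomputable def kernelE (t : ℝ) : ℝ≥0∞ :=
  (Ioo (-1) 1).indicator (fun t => ENNReal.ofReal (1 / |t|)) t

/-- The measure `1_{|x - y| < 1} / |x - y| dx dy`. -/
noncomputable def nu : Measure (ℝ × ℝ) := volume.withDensity fun p => kernelE (p.2 - p.1)

/-- The difference `u(x) - u(y)` as a function of `(x, y)`. -/
def diff (u : ℝ → ℝ) (p : ℝ × ℝ) : ℝ := u p.1 - u p.2

/-- The energy `ℰ(u,u)`, with values in `[0, ∞]`. -/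
noncomputable def energy (u : ℝ → ℝ) : ℝ≥0∞ := ∫⁻ p, ‖diff u p‖ₑ ^ 2 ∂nu

theorem measurable_kernelE : Measurable kernelE :=
  (by fun_prop : Measurable fun t : ℝ => ENNReal.ofReal (1 / |t|)).indicator measurableSet_Ioo

theorem measurable_density : Measurable fun p : ℝ × ℝ => kernelE (p.2 - p.1) :=
  measurable_kernelE.comp (measurable_snd.sub measurable_fst)

/-- At `t = 0` the convention `1 / 0 = 0` gives the value `0`, so the density of `nu` is finite
everywhere. -/
theorem kernelE_ne_top (t : ℝ) : kernelE t ≠ ∞ := by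
  unfold kernelE indicator; split_ifs <;> simp

theorem nu_absolutelyContinuous : nu ≪ volume := withDensity_absolutelyContinuous _ _

theorem aemeasurable_fst_comp {u : ℝ → ℝ} (hu : AEMeasurable u) :
    AEMeasurable (fun p : ℝ × ℝ => u p.1) :=
  hu.comp_quasiMeasurePreserving Measure.quasiMeasurePreserving_fst

theorem aemeasurable_snd_comp {u : ℝ → ℝ} (hu : AEMeasurable u) :
    AEMeasurable (fun p : ℝ × ℝ => u p.2) :=
  hu.comp_quasiMeasurePreserving Measure.quasiMeasurePreserving_snd

theorem aemeasurable_diff {u : ℝ → ℝ} (hu : AEMeasurable u) : AEMeasurable (diff u) :=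
  (aemeasurable_fst_comp hu).sub (aemeasurable_snd_comp hu)

theorem diff_ae_eq {u v : ℝ → ℝ} (h : u =ᵐ[volume] v) : diff u =ᵐ[nu] diff v := by
  refine nu_absolutelyContinuous.ae_eq ?_
  have h1 := Measure.quasiMeasurePreserving_fst (μ := (volume : Measure ℝ))
    (ν := (volume : Measure ℝ)) |>.ae_eq_comp h
  have h2 := Measure.quasiMeasurePreserving_snd (μ := (volume : Measure ℝ))
    (ν := (volume : Measure ℝ)) |>.ae_eq_comp h
  filter_upwards [h1, h2] with p hp1 hp2
  simp only [Function.comp] at hp1 hp2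
  simp [diff, hp1, hp2]

theorem energy_congr {u v : ℝ → ℝ} (h : u =ᵐ[volume] v) : energy u = energy v := by
  refine lintegral_congr_ae ?_
  filter_upwards [diff_ae_eq h] with p hp
  rw [hp]

theorem lintegral_nu {F : ℝ × ℝ → ℝ≥0∞} (hF : AEMeasurable F) :
    ∫⁻ p, F p ∂nu = ∫⁻ p : ℝ × ℝ, kernelE (p.2 - p.1) * F p := by
  rw [nu, lintegral_withDensity_eq_lintegral_mul₀ measurable_density.aemeasurable hF]
  rfl

theorem kernelE_indicator_ball (x y : ℝ) :
    kernelE (y - x) = (Metric.ball x 1).indicator (fun y => ENNReal.ofReal (1 / |x - y|)) y := by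
  have : y - x ∈ Ioo (-1 : ℝ) 1 ↔ y ∈ Metric.ball x 1 := by
    rw [Metric.mem_ball, Real.dist_eq, abs_lt, mem_Ioo]
  unfold kernelE
  by_cases h : y ∈ Metric.ball x 1
  · rw [indicator_of_mem h, indicator_of_mem (this.2 h), abs_sub_comm]
  · rw [indicator_of_notMem h, indicator_of_notMem (this.not.2 h)]

theorem enorm_sq_eq (a : ℝ) : ‖a‖ₑ ^ 2 = ENNReal.ofReal (a ^ 2) := by
  rw [← ofReal_norm, ← ENNReal.ofReal_pow (norm_nonneg _), Real.norm_eq_abs, sq_abs]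

theorem energy_eq_iterated {u : ℝ → ℝ} (hu : AEMeasurable u) :
    energy u = ∫⁻ x, ∫⁻ y, kernelE (y - x) * ‖u x - u y‖ₑ ^ 2 := by
  have hm : AEMeasurable fun p => ‖diff u p‖ₑ ^ 2 := (aemeasurable_diff hu).enorm.pow_const 2
  have hG : AEMeasurable fun p : ℝ × ℝ => kernelE (p.2 - p.1) * ‖diff u p‖ₑ ^ 2 :=
    measurable_density.aemeasurable.mul hm
  rw [energy, lintegral_nu hm, Measure.volume_eq_prod, lintegral_prod _ hG]
  rfl

theorem energy_eq {u : ℝ → ℝ} (hu : AEMeasurable u) :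
    energy u = ∫⁻ x, ∫⁻ y in Metric.ball x 1, ENNReal.ofReal ((u x - u y) ^ 2 / |x - y|) := by
  rw [energy_eq_iterated hu]
  refine lintegral_congr fun x => ?_
  rw [← lintegral_indicator Metric.isOpen_ball.measurableSet]
  refine lintegral_congr fun y => ?_
  simp only [kernelE_indicator_ball]
  by_cases h : y ∈ Metric.ball x 1
  · rw [indicator_of_mem h, indicator_of_mem h, enorm_sq_eq, ← ENNReal.ofReal_mul
      (by positivity)]
    congr 1; ring
  · rw [indicator_of_notMem h, indicator_of_notMem h, zero_mul]

/-- The measure-preserving shear `(x, t) ↦ (x, x + t)` reduces energy bounds to `L²` moduli of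
continuity under translation. -/
theorem energy_eq_shear {u : ℝ → ℝ} (hu : AEMeasurable u) :
    energy u = ∫⁻ t, kernelE t * ∫⁻ x, ‖u x - u (x + t)‖ₑ ^ 2 := by
  have hm : AEMeasurable fun p => ‖diff u p‖ₑ ^ 2 := (aemeasurable_diff hu).enorm.pow_const 2
  have hmp : MeasurePreserving (fun z : ℝ × ℝ => (z.1, z.1 + z.2)) := by
    rw [Measure.volume_eq_prod]; exact measurePreserving_prod_add volume volume
  have hG : AEMeasurable fun p : ℝ × ℝ => kernelE (p.2 - p.1) * ‖diff u p‖ₑ ^ 2 :=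
    measurable_density.aemeasurable.mul hm
  rw [energy, lintegral_nu hm]
  have h1 : ∫⁻ p : ℝ × ℝ, kernelE (p.2 - p.1) * ‖diff u p‖ₑ ^ 2
      = ∫⁻ p : ℝ × ℝ, kernelE p.2 * ‖u p.1 - u (p.1 + p.2)‖ₑ ^ 2 := by
    have := lintegral_map' (μ := volume) (g := fun z : ℝ × ℝ => (z.1, z.1 + z.2))
      (by rw [hmp.map_eq]; exact hG) hmp.measurable.aemeasurable
    rw [hmp.map_eq] at this
    rw [this]
    refine lintegral_congr fun p => ?_
    simp [diff]
  have hG' : AEMeasurable fun p : ℝ × ℝ => kernelE p.2 * ‖u p.1 - u (p.1 + p.2)‖ₑ ^ 2 := by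
    have := hG.comp_quasiMeasurePreserving hmp.quasiMeasurePreserving
    refine this.congr (Eventually.of_forall fun p => ?_)
    simp [diff]
  rw [h1, Measure.volume_eq_prod, lintegral_prod_symm _ hG']
  refine lintegral_congr fun t => ?_
  exact lintegral_const_mul' _ _ (kernelE_ne_top t)

theorem eLpNorm_two_sq {α : Type*} [MeasurableSpace α] (m : Measure α) (f : α → ℝ) :
    eLpNorm f 2 m ^ 2 = ∫⁻ a, ‖f a‖ₑ ^ 2 ∂m := by
  rw [eLpNorm_eq_lintegral_rpow_enorm_toReal (by norm_num) (by norm_num)]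
  simp only [ENNReal.toReal_ofNat, ENNReal.rpow_ofNat]
  rw [← ENNReal.rpow_natCast, ← ENNReal.rpow_mul]
  norm_num

theorem memLp_two_iff {α : Type*} [MeasurableSpace α] {m : Measure α} {f : α → ℝ} :
    MemLp f 2 m ↔ AEStronglyMeasurable f m ∧ ∫⁻ a, ‖f a‖ₑ ^ 2 ∂m < ∞ := by
  rw [MemLp, ← eLpNorm_two_sq]
  simp

theorem memH_iff {L : ℝ} {u : ℝ → ℝ} :
    MemH L u ↔ MemLp u 2 volume ∧ (∀ x, x ∉ Ioo 0 L → u x = 0) ∧ energy u < ∞ := by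
  constructor
  · rintro ⟨h1, h2, h3⟩
    exact ⟨h1, h2, by rwa [energy_eq h1.1.aemeasurable]⟩
  · rintro ⟨h1, h2, h3⟩
    exact ⟨h1, h2, by rwa [energy_eq h1.1.aemeasurable] at h3⟩

theorem MemH.energy_lt {L : ℝ} {u : ℝ → ℝ} (h : MemH L u) : energy u < ∞ := (memH_iff.1 h).2.2

theorem MemH.aemeasurable {L : ℝ} {u : ℝ → ℝ} (h : MemH L u) : AEMeasurable u :=
  h.memLp.1.aemeasurable

theorem aestronglyMeasurable_diff {u : ℝ → ℝ} (hu : AEMeasurable u) :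
    AEStronglyMeasurable (diff u) nu :=
  ((aemeasurable_diff hu).mono_ac nu_absolutelyContinuous).aestronglyMeasurable

theorem MemH.memLp_diff {L : ℝ} {u : ℝ → ℝ} (h : MemH L u) : MemLp (diff u) 2 nu :=
  memLp_two_iff.2 ⟨aestronglyMeasurable_diff h.aemeasurable, h.energy_lt⟩

theorem memH_of_memLp_diff {L : ℝ} {u : ℝ → ℝ} (h1 : MemLp u 2 volume)
    (h2 : ∀ x, x ∉ Ioo 0 L → u x = 0) (h3 : MemLp (diff u) 2 nu) : MemH L u :=
  memH_iff.2 ⟨h1, h2, (memLp_two_iff.1 h3).2⟩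

/-- Finite energy of both functions makes the product integrable for `nu`, which is what allows
Fubini to reach the iterated integral. -/
theorem formE_eq {L : ℝ} {u v : ℝ → ℝ} (hu : MemH L u) (hv : MemH L v) :
    formE u v = ∫ p, diff u p * diff v p ∂nu := by
  have hint : Integrable (fun p => diff u p * diff v p) nu :=
    hu.memLp_diff.integrable_mul hv.memLp_diff
  rw [nu, integrable_withDensity_iff_integrable_smul' measurable_density
    (Eventually.of_forall fun p => (kernelE_ne_top _).lt_top)] at hint
  rw [nu, integral_withDensity_eq_integral_toReal_smul measurable_density
    (Eventually.of_forall fun p => (kernelE_ne_top _).lt_top)]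
  rw [Measure.volume_eq_prod] at hint ⊢
  rw [integral_prod _ hint, formE]
  refine integral_congr_ae (Eventually.of_forall fun x => ?_)
  simp only
  rw [← integral_indicator Metric.isOpen_ball.measurableSet]
  refine integral_congr_ae (Eventually.of_forall fun y => ?_)
  simp only [kernelE_indicator_ball]
  by_cases h : y ∈ Metric.ball x 1
  · rw [indicator_of_mem h, indicator_of_mem h, ENNReal.toReal_ofReal (by positivity)]
    simp only [diff, smul_eq_mul]; ring
  · rw [indicator_of_notMem h, indicator_of_notMem h]; simp

theorem formE_self {L : ℝ} {u : ℝ → ℝ} (hu : MemH L u) : formE u u = (energy u).toReal := by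
  rw [formE_eq hu hu, energy, integral_eq_lintegral_of_nonneg_ae
    (Eventually.of_forall fun p => mul_self_nonneg _)
    (hu.memLp_diff.integrable_mul hu.memLp_diff).1]
  congr 1
  refine lintegral_congr fun p => ?_
  rw [enorm_sq_eq, pow_two]

theorem diff_add (u v : ℝ → ℝ) : diff (u + v) = diff u + diff v := by
  ext p; simp only [diff, Pi.add_apply]; ring

theorem diff_smul (c : ℝ) (u : ℝ → ℝ) : diff (c • u) = c • diff u := by
  ext p; simp only [diff, Pi.smul_apply, smul_eq_mul]; ring

theorem MemH.add {u v : ℝ → ℝ} (hu : MemH L u) (hv : MemH L v) : MemH L (u + v) :=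
  memH_of_memLp_diff (hu.memLp.add hv.memLp)
    (fun x hx => by simp [hu.eq_zero x hx, hv.eq_zero x hx])
    (by rw [diff_add]; exact hu.memLp_diff.add hv.memLp_diff)

theorem MemH.smul {u : ℝ → ℝ} (hu : MemH L u) (c : ℝ) : MemH L (c • u) :=
  memH_of_memLp_diff (hu.memLp.const_smul c) (fun x hx => by simp [hu.eq_zero x hx])
    (by rw [diff_smul]; exact hu.memLp_diff.const_smul c)

theorem memH_zero : MemH L 0 :=
  memH_of_memLp_diff MemLp.zero (fun _ _ => rfl)
    (by have : diff 0 = 0 := by ext p; simp [diff]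
        rw [this]; exact MemLp.zero)

theorem MemH.congr {u v : ℝ → ℝ} (hu : MemH L u) (h : u =ᵐ[volume] v)
    (hv : ∀ x, x ∉ Ioo 0 L → v x = 0) : MemH L v :=
  memH_of_memLp_diff (hu.memLp.ae_eq h) hv (hu.memLp_diff.ae_eq (diff_ae_eq h))

/-! ### The Hilbert space of classes, as a graph in `L²(Ω) × L²(ν)` -/

/-- `ℍ(Ω)` as a space of functions. -/
def functionSpace (L : ℝ) : Submodule ℝ (ℝ → ℝ) where
  carrier := {u | MemH L u}
  add_mem' := MemH.add
  zero_mem' := memH_zero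
  smul_mem' c _ hu := MemH.smul hu c

/-- `L²(Ω)`. -/
noncomputable abbrev L2Omega (L : ℝ) := Lp ℝ 2 (volume.restrict (Ioo 0 L) : Measure ℝ)

/-- The space `L²(Ω) × L²(ν)` containing the graph of `u ↦ u(x) - u(y)`. -/
noncomputable abbrev GraphAmbient (L : ℝ) := WithLp 2 (L2Omega L × Lp ℝ 2 nu)

/-- The map sending `u` to the pair of `u` and `u(x) - u(y)`. -/
noncomputable def graphMap (L : ℝ) : functionSpace L →ₗ[ℝ] GraphAmbient L where
  toFun u := WithLp.toLp 2 ((u.2.memLp.restrict _).toLp u.1, u.2.memLp_diff.toLp (diff u.1))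
  map_add' u v := by
    rw [← WithLp.toLp_add, Prod.mk_add_mk, ← MemLp.toLp_add, ← MemLp.toLp_add]
    simp only [Submodule.coe_add, diff_add]
  map_smul' c u := by
    rw [RingHom.id_apply, ← WithLp.toLp_smul, Prod.smul_mk, ← MemLp.toLp_const_smul,
      ← MemLp.toLp_const_smul]
    simp only [Submodule.coe_smul, diff_smul]

/-- `ℍ(Ω)` as a space of classes with the graph norm. -/
noncomputable def hilbertSpace (L : ℝ) : Submodule ℝ (GraphAmbient L) := LinearMap.range (graphMap L)

theorem ae_of_ae_restrict {p : ℝ → Prop} (h : ∀ᵐ x ∂(volume.restrict (Ioo 0 L)), p x)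
    (h' : ∀ x, x ∉ Ioo 0 L → p x) : ∀ᵐ x, p x := by
  filter_upwards [(ae_restrict_iff' measurableSet_Ioo).1 h] with x hx
  by_cases hxL : x ∈ Ioo 0 L
  · exact hx hxL
  · exact h' x hxL

/-- The map `u ↦ diff u` is a closed operator: along a subsequence both components converge almost
everywhere, and `nu ≪ volume` lets the pointwise limit of `u` determine that of `diff u`. -/
theorem isClosed_hilbertSpace : IsClosed (hilbertSpace L : Set (GraphAmbient L)) := by
  refine IsSeqClosed.isClosed fun x z hx hlim => ?_
  choose u hu using hx
  have h1 : Tendsto (fun n => (x n).fst) atTop (𝓝 z.fst) :=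
    ((WithLp.fstL 2 ℝ (L2Omega L) (Lp ℝ 2 nu)).continuous.tendsto z).comp hlim
  have h2 : Tendsto (fun n => (x n).snd) atTop (𝓝 z.snd) :=
    ((WithLp.sndL 2 ℝ (L2Omega L) (Lp ℝ 2 nu)).continuous.tendsto z).comp hlim
  have hx1 : ∀ n, (x n).fst = ((u n).2.memLp.restrict _).toLp (u n).1 := fun n => by
    rw [← hu n]; rfl
  have hx2 : ∀ n, (x n).snd = (u n).2.memLp_diff.toLp (diff (u n).1) := fun n => by
    rw [← hu n]; rfl
  obtain ⟨φ, hφ, hφlim⟩ := (tendstoInMeasure_of_tendsto_Lp h1).exists_seq_tendsto_ae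
  obtain ⟨ψ, hψ, hψlim⟩ := (tendstoInMeasure_of_tendsto_Lp
    (h2.comp hφ.tendsto_atTop)).exists_seq_tendsto_ae
  -- The limit class lives on `Ω` only; extension by zero yields a function on the line that
  -- vanishes outside `Ω`.
  set f : ℝ → ℝ := (Ioo 0 L).indicator z.fst with hf
  have hfmem : MemLp f 2 volume :=
    (memLp_indicator_iff_restrict measurableSet_Ioo).2 (Lp.memLp z.fst)
  have hae : ∀ᵐ x, Tendsto (fun n => (u (φ n)).1 x) atTop (𝓝 (f x)) := by
    refine ae_of_ae_restrict (L := L) ?_ fun x hx => ?_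
    · have h3 : ∀ᵐ y ∂(volume.restrict (Ioo 0 L)), ∀ n, (x n).fst y = (u n).1 y :=
        ae_all_iff.2 fun n => by rw [hx1 n]; exact MemLp.coeFn_toLp _
      filter_upwards [hφlim, h3, ae_restrict_mem measurableSet_Ioo] with y hy h3 hyL
      rw [hf, indicator_of_mem hyL]
      simpa only [h3] using hy
    · rw [hf, indicator_of_notMem hx]
      simp only [(u _).2.eq_zero x hx]
      exact tendsto_const_nhds
  have hdiff : ∀ᵐ p ∂nu, Tendsto (fun n => diff (u (φ n)).1 p) atTop (𝓝 (diff f p)) := by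
    refine nu_absolutelyContinuous.ae_le ?_
    have h3 := (Measure.quasiMeasurePreserving_fst (μ := (volume : Measure ℝ))
      (ν := (volume : Measure ℝ))).ae hae
    have h4 := (Measure.quasiMeasurePreserving_snd (μ := (volume : Measure ℝ))
      (ν := (volume : Measure ℝ))).ae hae
    filter_upwards [h3, h4] with p hp3 hp4
    exact hp3.sub hp4
  have heq : z.snd =ᵐ[nu] diff f := by
    have h3 : ∀ᵐ y ∂nu, ∀ n, (x n).snd y = diff (u n).1 y :=
      ae_all_iff.2 fun n => by rw [hx2 n]; exact MemLp.coeFn_toLp _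
    filter_upwards [hψlim, h3, hdiff] with p hp h3 h4
    simp only [Function.comp, h3] at hp
    exact tendsto_nhds_unique hp (h4.comp hψ.tendsto_atTop)
  have hfH : MemH L f := memH_of_memLp_diff hfmem (fun x hx => indicator_of_notMem hx _)
    ((Lp.memLp z.snd).ae_eq heq)
  refine ⟨⟨f, hfH⟩, ?_⟩
  have e1 : (hfH.memLp.restrict _).toLp f = z.fst := by
    refine Lp.ext ((MemLp.coeFn_toLp _).trans ?_)
    exact indicator_ae_eq_restrict measurableSet_Ioo
  have e2 : hfH.memLp_diff.toLp (diff f) = z.snd :=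
    Lp.ext ((MemLp.coeFn_toLp _).trans heq.symm)
  change WithLp.toLp 2 (_, _) = z
  rw [e1, e2]
  rfl

instance : CompleteSpace (hilbertSpace L) := isClosed_hilbertSpace.completeSpace_coe

/-- The class of a function of finite energy. -/
noncomputable def toHilbert (L : ℝ) : functionSpace L →ₗ[ℝ] hilbertSpace L :=
  (graphMap L).rangeRestrict

theorem toHilbert_surjective : Function.Surjective (toHilbert L) :=
  (graphMap L).surjective_rangeRestrict

/-- The embedding of `ℍ(Ω)` into `L²(Ω)`. -/
noncomputable def embedding (L : ℝ) : hilbertSpace L →L[ℝ] L2Omega L :=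
  (WithLp.fstL 2 ℝ (L2Omega L) (Lp ℝ 2 nu)) ∘L (hilbertSpace L).subtypeL

theorem embedding_toHilbert (u : functionSpace L) :
    embedding L (toHilbert L u) = (u.2.memLp.restrict _).toLp u.1 := rfl

theorem ae_eq_of_restrict {u v : ℝ → ℝ} (hu : ∀ x, x ∉ Ioo 0 L → u x = 0)
    (hv : ∀ x, x ∉ Ioo 0 L → v x = 0) (h : u =ᵐ[volume.restrict (Ioo 0 L)] v) :
    u =ᵐ[volume] v :=
  ae_of_ae_restrict h fun x hx => by rw [hu x hx, hv x hx]

theorem toLp_eq_zero {α : Type*} [MeasurableSpace α] {m : Measure α} {f : α → ℝ}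
    (hf : MemLp f 2 m) : hf.toLp f = 0 ↔ f =ᵐ[m] 0 := by
  rw [Lp.eq_zero_iff_ae_eq_zero]
  exact ⟨fun h => hf.coeFn_toLp.symm.trans h, fun h => hf.coeFn_toLp.trans h⟩

/-- Elements vanish outside `Ω`, so the class on `Ω` fixes `u` almost everywhere on the line, and
with it `diff u`. -/
theorem embedding_injective : Function.Injective (embedding L) := by
  rw [injective_iff_map_eq_zero]
  intro z hz
  obtain ⟨u, rfl⟩ := toHilbert_surjective z
  rw [embedding_toHilbert] at hz
  have h0 : u.1 =ᵐ[volume] 0 := by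
    refine ae_eq_of_restrict u.2.eq_zero (fun _ _ => rfl) ?_
    exact (toLp_eq_zero _).1 hz
  refine Subtype.ext ?_
  change WithLp.toLp 2 (_, _) = 0
  rw [WithLp.toLp_eq_zero, Prod.mk_eq_zero]
  refine ⟨hz, (toLp_eq_zero _).2 ((diff_ae_eq h0).trans ?_)⟩
  exact Eventually.of_forall fun p => by simp [diff]

theorem toHilbert_eq_iff (u v : functionSpace L) :
    toHilbert L u = toHilbert L v ↔ u.1 =ᵐ[volume] v.1 := by
  rw [← embedding_injective.eq_iff, embedding_toHilbert, embedding_toHilbert,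
    MemLp.toLp_eq_toLp_iff]
  exact ⟨ae_eq_of_restrict u.2.eq_zero v.2.eq_zero, fun h => ae_restrict_of_ae h⟩

theorem inner_toLp {α : Type*} [MeasurableSpace α] {m : Measure α} {f g : α → ℝ}
    (hf : MemLp f 2 m) (hg : MemLp g 2 m) :
    ⟪hf.toLp f, hg.toLp g⟫_ℝ = ∫ a, f a * g a ∂m := by
  rw [L2.inner_def]
  refine integral_congr_ae ?_
  filter_upwards [hf.coeFn_toLp, hg.coeFn_toLp] with a h1 h2
  rw [h1, h2]
  simp [mul_comm]

theorem integral_eq_setIntegral {f : ℝ → ℝ} (hf : ∀ x, x ∉ Ioo 0 L → f x = 0) :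
    ∫ x, f x = ∫ x in Ioo 0 L, f x :=
  (setIntegral_eq_integral_of_forall_compl_eq_zero hf).symm

theorem inner_toHilbert (u v : functionSpace L) :
    ⟪toHilbert L u, toHilbert L v⟫_ℝ = (∫ x, u.1 x * v.1 x) + formE u.1 v.1 := by
  rw [formE_eq u.2 v.2, integral_eq_setIntegral (L := L) fun x hx => by simp [u.2.eq_zero x hx],
    ← inner_toLp (u.2.memLp.restrict _) (v.2.memLp.restrict _),
    ← inner_toLp u.2.memLp_diff v.2.memLp_diff]
  rfl

/-! ### The far-field operator and the identity `ℰ_L(u,v) = ⟨u + K u, v⟩` -/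

/-- The kernel `1_{|x - y| ≥ 1} / |x - y|`. -/
noncomputable def kernelB (p : ℝ × ℝ) : ℝ :=
  {p : ℝ × ℝ | 1 ≤ |p.1 - p.2|}.indicator (fun p => 1 / |p.1 - p.2|) p

theorem measurableSet_far : MeasurableSet {p : ℝ × ℝ | 1 ≤ |p.1 - p.2|} :=
  (isClosed_le continuous_const (by fun_prop)).measurableSet

theorem measurable_kernelB : Measurable kernelB :=
  (by fun_prop : Measurable fun p : ℝ × ℝ => 1 / |p.1 - p.2|).indicator measurableSet_far

theorem abs_kernelB_le (p : ℝ × ℝ) : |kernelB p| ≤ 1 := by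
  unfold kernelB indicator
  split_ifs with h
  · have h' : 1 ≤ |p.1 - p.2| := h
    rw [abs_of_nonneg (by positivity)]
    exact (div_le_one (by linarith)).2 h'
  · simp

/-- Lebesgue measure on `Ω × Ω`. -/
noncomputable abbrev squareMeasure (L : ℝ) : Measure (ℝ × ℝ) :=
  ((volume : Measure ℝ).restrict (Ioo 0 L)).prod ((volume : Measure ℝ).restrict (Ioo 0 L))

theorem integrable_L2Omega (f : L2Omega L) : Integrable f (volume.restrict (Ioo 0 L)) :=
  (Lp.memLp f).integrable (by norm_num)

theorem integrable_kernelB_mul (f g : L2Omega L) :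
    Integrable (fun p : ℝ × ℝ => kernelB p * (f p.1 * g p.2)) (squareMeasure L) :=
  ((integrable_L2Omega f).mul_prod (integrable_L2Omega g)).bdd_mul
    measurable_kernelB.aestronglyMeasurable (Eventually.of_forall abs_kernelB_le)

theorem ae_fst {f g : ℝ → ℝ} (h : f =ᵐ[volume.restrict (Ioo 0 L)] g) :
    ∀ᵐ p ∂(squareMeasure L), f p.1 = g p.1 :=
  Measure.quasiMeasurePreserving_fst.ae h

theorem ae_snd {f g : ℝ → ℝ} (h : f =ᵐ[volume.restrict (Ioo 0 L)] g) :
    ∀ᵐ p ∂(squareMeasure L), f p.2 = g p.2 :=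
  Measure.quasiMeasurePreserving_snd.ae h

/-- The far-field part of the form as a bilinear map on `L²(Ω)`. -/
noncomputable def farForm (L : ℝ) : L2Omega L →ₗ[ℝ] L2Omega L →ₗ[ℝ] ℝ :=
  LinearMap.mk₂ ℝ (fun f g => ∫ p, kernelB p * (f p.1 * g p.2) ∂(squareMeasure L))
    (fun f f' g => by
      rw [← integral_add (integrable_kernelB_mul f g) (integrable_kernelB_mul f' g)]
      refine integral_congr_ae ?_
      filter_upwards [ae_fst (Lp.coeFn_add f f')] with p hp
      rw [hp]; simp only [Pi.add_apply]; ring)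
    (fun c f g => by
      rw [smul_eq_mul, ← integral_const_mul]
      refine integral_congr_ae ?_
      filter_upwards [ae_fst (Lp.coeFn_smul c f)] with p hp
      rw [hp]; simp only [Pi.smul_apply, smul_eq_mul]; ring)
    (fun f g g' => by
      rw [← integral_add (integrable_kernelB_mul f g) (integrable_kernelB_mul f g')]
      refine integral_congr_ae ?_
      filter_upwards [ae_snd (Lp.coeFn_add g g')] with p hp
      rw [hp]; simp only [Pi.add_apply]; ring)
    (fun c f g => by
      rw [smul_eq_mul, ← integral_const_mul]
      refine integral_congr_ae ?_
      filter_upwards [ae_snd (Lp.coeFn_smul c g)] with p hp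
      rw [hp]; simp only [Pi.smul_apply, smul_eq_mul]; ring)

theorem farForm_apply (f g : L2Omega L) :
    farForm L f g = ∫ p, kernelB p * (f p.1 * g p.2) ∂(squareMeasure L) := rfl

theorem exists_integral_abs_le (L : ℝ) : ∃ C : ℝ, 0 ≤ C ∧ ∀ f : L2Omega L,
    ∫ x in Ioo 0 L, |f x| ≤ C * ‖f‖ := by
  have h1 : MemLp (fun _ : ℝ => (1 : ℝ)) 2 (volume.restrict (Ioo 0 L)) := memLp_const 1
  refine ⟨‖h1.toLp _‖, norm_nonneg _, fun f => ?_⟩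
  have habs : MemLp (fun x => |f x|) 2 (volume.restrict (Ioo 0 L)) := (Lp.memLp f).abs
  have h2 := inner_toLp habs h1
  simp only [mul_one] at h2
  rw [← h2]
  have h3 : ‖habs.toLp _‖ = ‖f‖ := by
    rw [Lp.norm_toLp, Lp.norm_def]
    congr 1
    exact eLpNorm_congr_norm_ae (Eventually.of_forall fun x => by simp)
  rw [mul_comm, ← h3]
  exact real_inner_le_norm _ _

/-- The kernel is at most `1` and `Ω` has finite measure, so the form is dominated by a product of
`L¹` norms. -/
theorem exists_farForm_bound (L : ℝ) : ∃ C : ℝ, ∀ f g : L2Omega L,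
    ‖farForm L f g‖ ≤ C * ‖f‖ * ‖g‖ := by
  obtain ⟨C, hC, h⟩ := exists_integral_abs_le L
  refine ⟨C * C, fun f g => ?_⟩
  rw [farForm_apply]
  calc _ ≤ ∫ p, |f p.1| * |g p.2| ∂(squareMeasure L) := by
        refine norm_integral_le_of_norm_le
          ((integrable_L2Omega f).abs.mul_prod (integrable_L2Omega g).abs)
          (Eventually.of_forall fun p => ?_)
        rw [Real.norm_eq_abs, abs_mul, abs_mul]
        exact mul_le_of_le_one_left (by positivity) (abs_kernelB_le p)
    _ = (∫ x in Ioo 0 L, |f x|) * ∫ x in Ioo 0 L, |g x| :=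
        integral_prod_mul (fun x => |f x|) fun x => |g x|
    _ ≤ (C * ‖f‖) * (C * ‖g‖) := by
        exact mul_le_mul (h f) (h g) (integral_nonneg fun _ => abs_nonneg _) (by positivity)
    _ = _ := by ring

/-- The far-field part of the form as an operator on `L²(Ω)`. -/
noncomputable def farOperator (L : ℝ) : L2Omega L →L[ℝ] L2Omega L :=
  InnerProductSpace.continuousLinearMapOfBilin (𝕜 := ℝ)
    ((farForm L).mkContinuous₂ (exists_farForm_bound L).choose (exists_farForm_bound L).choose_spec)

theorem inner_farOperator (f g : L2Omega L) : ⟪farOperator L f, g⟫_ℝ = farForm L f g := by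
  rw [farOperator, InnerProductSpace.continuousLinearMapOfBilin_apply]
  rfl

/-- The operator on `ℍ(Ω)` for which `ℰ_L(u,v) = ⟨u + K u, v⟩`. -/
noncomputable def perturbation (L : ℝ) : hilbertSpace L →L[ℝ] hilbertSpace L :=
  ContinuousLinearMap.adjoint (embedding L) ∘L
    ((rho₁ - 1) • ContinuousLinearMap.id ℝ (L2Omega L) - farOperator L) ∘L embedding L

theorem farForm_toLp (u v : functionSpace L) :
    farForm L (embedding L (toHilbert L u)) (embedding L (toHilbert L v))
      = ∫ p in {p : ℝ × ℝ | 1 ≤ |p.1 - p.2|}, u.1 p.1 * v.1 p.2 / |p.1 - p.2| := by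
  have e1 : ∫ p in {p : ℝ × ℝ | 1 ≤ |p.1 - p.2|}, u.1 p.1 * v.1 p.2 / |p.1 - p.2|
      = ∫ p, kernelB p * (u.1 p.1 * v.1 p.2) := by
    rw [← integral_indicator measurableSet_far]
    refine integral_congr_ae (Eventually.of_forall fun p => ?_)
    simp only [kernelB, indicator]
    split_ifs
    · ring
    · ring
  have e2 : ∫ p, kernelB p * (u.1 p.1 * v.1 p.2)
      = ∫ p in Ioo 0 L ×ˢ Ioo 0 L, kernelB p * (u.1 p.1 * v.1 p.2) := by
    refine (setIntegral_eq_integral_of_forall_compl_eq_zero fun p hp => ?_).symm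
    rw [mem_prod, not_and_or] at hp
    rcases hp with hp | hp
    · rw [u.2.eq_zero _ hp]; ring
    · rw [v.2.eq_zero _ hp]; ring
  rw [e1, e2, farForm_apply, squareMeasure, Measure.prod_restrict]
  rw [← Measure.volume_eq_prod]
  refine integral_congr_ae ?_
  have h1 := ae_fst (L := L) (MemLp.coeFn_toLp (u.2.memLp.restrict (Ioo 0 L)))
  have h2 := ae_snd (L := L) (MemLp.coeFn_toLp (v.2.memLp.restrict (Ioo 0 L)))
  rw [squareMeasure, Measure.prod_restrict, ← Measure.volume_eq_prod] at h1 h2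
  filter_upwards [h1, h2] with p hp1 hp2
  rw [embedding_toHilbert, embedding_toHilbert, hp1, hp2]

/-- The graph inner product contains an extra `∫ u v`; the coefficient `rho₁ - 1` in `perturbation`
takes it off again. -/
theorem formEL_eq (u v : functionSpace L) :
    formEL u.1 v.1 = ⟪toHilbert L u + perturbation L (toHilbert L u), toHilbert L v⟫_ℝ := by
  rw [inner_add_left, inner_toHilbert, perturbation, ContinuousLinearMap.comp_apply,
    ContinuousLinearMap.adjoint_inner_left, ContinuousLinearMap.comp_apply,
    sub_apply, inner_sub_left, inner_farOperator, farForm_toLp,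
    smul_apply, ContinuousLinearMap.id_apply, inner_smul_left,
    embedding_toHilbert, embedding_toHilbert, inner_toLp,
    ← integral_eq_setIntegral fun x hx => by simp [u.2.eq_zero x hx], formEL, formB]
  simp only [conj_trivial]
  ring

theorem isCompactOperator_perturbation (h : IsCompactOperator (embedding L)) :
    IsCompactOperator (perturbation L) :=
  h.clm_comp (ContinuousLinearMap.adjoint (embedding L) ∘L
    ((rho₁ - 1) • ContinuousLinearMap.id ℝ (L2Omega L) - farOperator L))

/-- A kernel vector of `1 + K` is the class of a weak solution with zero right-hand side. -/
theorem perturbation_injective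
    (htriv : ∀ u : ℝ → ℝ, IsWeakSolution L 0 u → u =ᵐ[volume] 0) (x : hilbertSpace L)
    (hx : x + perturbation L x = 0) : x = 0 := by
  obtain ⟨u, rfl⟩ := toHilbert_surjective x
  rw [← map_zero (toHilbert L), toHilbert_eq_iff]
  refine htriv u.1 ⟨u.2, fun v hv => ?_⟩
  rw [formEL_eq u ⟨v, hv⟩, hx]
  simp

/-! ### Poincaré inequality -/

theorem enorm_integral_sq_le {α : Type*} [MeasurableSpace α] (m : Measure α) {f : α → ℝ}
    (hf : AEStronglyMeasurable f m) :
    ‖∫ a, f a ∂m‖ₑ ^ 2 ≤ m univ * ∫⁻ a, ‖f a‖ₑ ^ 2 ∂m := by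
  have h1 : ‖∫ a, f a ∂m‖ₑ ≤ eLpNorm f 1 m := by
    rw [eLpNorm_one_eq_lintegral_enorm]; exact enorm_integral_le_lintegral_enorm f
  have h2 := eLpNorm_le_eLpNorm_mul_rpow_measure_univ (μ := m) (p := 1) (q := 2) (by norm_num) hf
  calc _ ≤ (eLpNorm f 2 m * m univ ^ (1 / (1 : ℝ≥0∞).toReal - 1 / (2 : ℝ≥0∞).toReal)) ^ 2 := by
        gcongr; exact h1.trans h2
    _ = _ := by
        rw [mul_pow, eLpNorm_two_sq, mul_comm, ← ENNReal.rpow_natCast, ← ENNReal.rpow_mul]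
        norm_num

theorem norm_toLp_sq {α : Type*} [MeasurableSpace α] {m : Measure α} {f : α → ℝ}
    (hf : MemLp f 2 m) : ‖hf.toLp f‖ ^ 2 = (∫⁻ a, ‖f a‖ₑ ^ 2 ∂m).toReal := by
  rw [Lp.norm_toLp, ← ENNReal.toReal_pow, eLpNorm_two_sq]

theorem norm_toHilbert_sq (u : functionSpace L) :
    ‖toHilbert L u‖ ^ 2 = ‖embedding L (toHilbert L u)‖ ^ 2 + (energy u.1).toReal := by
  rw [← real_inner_self_eq_norm_sq, inner_toHilbert, formE_self u.2, embedding_toHilbert,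
    ← real_inner_self_eq_norm_sq, inner_toLp,
    ← integral_eq_setIntegral fun x hx => by simp [u.2.eq_zero x hx]]

theorem one_le_kernelE {t : ℝ} (h0 : 0 < t) (h1 : t < 1) : 1 ≤ kernelE t := by
  rw [kernelE, indicator_of_mem (by constructor <;> linarith), ENNReal.one_le_ofReal,
    abs_of_pos h0]
  exact (one_le_div h0).2 h1.le

theorem enorm_sq_le_two_mul (a b : ℝ) : ‖b‖ₑ ^ 2 ≤ 2 * ‖a‖ₑ ^ 2 + 2 * ‖a - b‖ₑ ^ 2 := by
  simp only [enorm_sq_eq]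
  rw [← ENNReal.ofReal_ofNat 2, ← ENNReal.ofReal_mul (by norm_num), ← ENNReal.ofReal_mul
    (by norm_num), ← ENNReal.ofReal_add (by positivity) (by positivity)]
  apply ENNReal.ofReal_le_ofReal
  nlinarith [sq_nonneg (2 * a - b)]

/-- A point of the left interval and one of the right interval are at distance less than `1`, where
the kernel is at least `1`. Integrating `|u y|² ≤ 2 |u x|² + 2 |u x - u y|²` over the product and
dividing by the length `1/2` gives the constants. -/
theorem lintegral_next_cell_le {u : ℝ → ℝ} (hu : AEMeasurable u) (c : ℝ) :
    ∫⁻ y in Ioc c (c + 1 / 2), ‖u y‖ₑ ^ 2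
      ≤ 2 * (∫⁻ x in Ioc (c - 1 / 2) c, ‖u x‖ₑ ^ 2) + 4 * energy u := by
  set I := Ioc c (c + 1 / 2) with hI
  set J := Ioc (c - 1 / 2) c with hJ
  set f : ℝ → ℝ≥0∞ := fun x => ‖u x‖ₑ ^ 2 with hf
  have hfm : AEMeasurable f := hu.enorm.pow_const 2
  have vI : (volume.restrict I) univ = ENNReal.ofReal (1 / 2) := by simp [hI]
  have vJ : (volume.restrict J) univ = ENNReal.ofReal (1 / 2) := by simp [hJ]
  have e1 : ∫⁻ p, f p.2 ∂((volume.restrict J).prod (volume.restrict I))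
      = ENNReal.ofReal (1 / 2) * ∫⁻ y in I, f y := by
    have := lintegral_prod_mul (μ := volume.restrict J) (ν := volume.restrict I)
      (f := fun _ => 1) (g := f) aemeasurable_const hfm.restrict
    simp only [one_mul, lintegral_one, vJ] at this
    exact this
  have e2 : ∫⁻ p, f p.1 ∂((volume.restrict J).prod (volume.restrict I))
      = (∫⁻ y in J, f y) * ENNReal.ofReal (1 / 2) := by
    have := lintegral_prod_mul (μ := volume.restrict J) (ν := volume.restrict I)
      (f := f) (g := fun _ => 1) hfm.restrict aemeasurable_const
    simp only [mul_one, lintegral_one, vI] at this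
    exact this
  have hm : AEMeasurable fun p => ‖diff u p‖ₑ ^ 2 := (aemeasurable_diff hu).enorm.pow_const 2
  have e3 : ∫⁻ p, ‖diff u p‖ₑ ^ 2 ∂((volume.restrict J).prod (volume.restrict I)) ≤ energy u := by
    rw [Measure.prod_restrict, ← Measure.volume_eq_prod, energy, lintegral_nu hm]
    refine le_trans ?_ (setLIntegral_le_lintegral (J ×ˢ I) _)
    refine setLIntegral_mono' (measurableSet_Ioc.prod measurableSet_Ioc) fun p hp => ?_
    obtain ⟨⟨h1, h2⟩, h3, h4⟩ := hp
    exact le_mul_of_one_le_left zero_le (one_le_kernelE (by linarith) (by linarith))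
  have hm' : AEMeasurable (fun p => ‖diff u p‖ₑ ^ 2)
      ((volume.restrict J).prod (volume.restrict I)) := by
    rw [Measure.prod_restrict]; exact hm.restrict
  have hle : ENNReal.ofReal (1 / 2) * ∫⁻ y in I, f y
      ≤ 2 * ((∫⁻ y in J, f y) * ENNReal.ofReal (1 / 2)) + 2 * energy u := by
    rw [← e1, ← e2]
    calc _ ≤ ∫⁻ p, (2 * f p.1 + 2 * ‖diff u p‖ₑ ^ 2)
          ∂((volume.restrict J).prod (volume.restrict I)) :=
          lintegral_mono fun p => enorm_sq_le_two_mul _ _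
      _ ≤ _ := by
          rw [lintegral_add_right' _ (hm'.const_mul 2), lintegral_const_mul' _ _ (by norm_num),
            lintegral_const_mul' _ _ (by norm_num)]
          gcongr
  have h2 : (2 : ℝ≥0∞) * ENNReal.ofReal (1 / 2) = 1 := by
    rw [← ENNReal.ofReal_ofNat 2, ← ENNReal.ofReal_mul (by norm_num)]; norm_num
  calc _ = 2 * (ENNReal.ofReal (1 / 2) * ∫⁻ y in I, f y) := by rw [← mul_assoc, h2, one_mul]
    _ ≤ 2 * (2 * ((∫⁻ y in J, f y) * ENNReal.ofReal (1 / 2)) + 2 * energy u) := by gcongr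
    _ = (2 * ENNReal.ofReal (1 / 2)) * (2 * ∫⁻ y in J, f y) + 4 * energy u := by ring
    _ = _ := by rw [h2, one_mul]

/-- Mass is propagated in steps of length `1/2` from `(-1/2, 0]`, where `u` vanishes; each step
replaces `C` by `3 C + 4`. -/
theorem exists_lintegral_Ioc_le (L : ℝ) (k : ℕ) : ∃ C : ℝ≥0∞, C ≠ ∞ ∧ ∀ u, MemH L u →
    ∫⁻ x in Ioc (-(1 / 2)) ((k : ℝ) / 2), ‖u x‖ₑ ^ 2 ≤ C * energy u := by
  induction k with
  | zero =>
    refine ⟨0, by simp, fun u hu => ?_⟩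
    rw [zero_mul, nonpos_iff_eq_zero]
    refine setLIntegral_eq_zero measurableSet_Ioc fun x hx => ?_
    have : u x = 0 := hu.eq_zero x fun h => by
      have := hx.2
      simp only [Nat.cast_zero, zero_div] at this
      linarith [h.1]
    simp [this]
  | succ k ih =>
    obtain ⟨C, hC, h⟩ := ih
    refine ⟨C + (2 * C + 4), by finiteness, fun u hu => ?_⟩
    have hk : (0 : ℝ) ≤ k := Nat.cast_nonneg k
    have hsub : Ioc (-(1 / 2)) (((k + 1 : ℕ) : ℝ) / 2)
        = Ioc (-(1 / 2)) ((k : ℝ) / 2) ∪ Ioc ((k : ℝ) / 2) ((k : ℝ) / 2 + 1 / 2) := by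
      rw [Ioc_union_Ioc_eq_Ioc (by linarith) (by linarith)]
      congr 1; push_cast; ring
    rw [hsub]
    refine (lintegral_union_le _ _ _).trans ?_
    have h1 := lintegral_next_cell_le hu.aemeasurable ((k : ℝ) / 2)
    have h2 : ∫⁻ x in Ioc ((k : ℝ) / 2 - 1 / 2) ((k : ℝ) / 2), ‖u x‖ₑ ^ 2
        ≤ ∫⁻ x in Ioc (-(1 / 2)) ((k : ℝ) / 2), ‖u x‖ₑ ^ 2 :=
      lintegral_mono_set (Ioc_subset_Ioc_left (by linarith))
    calc _ ≤ C * energy u + (2 * (C * energy u) + 4 * energy u) := by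
          refine add_le_add (h u hu) (h1.trans ?_)
          gcongr
          exact h2.trans (h u hu)
      _ = _ := by ring

/-- Poincaré inequality in `ℍ(Ω)`. -/
theorem exists_poincare (L : ℝ) : ∃ C : ℝ, 0 ≤ C ∧ ∀ u : functionSpace L,
    ‖toHilbert L u‖ ^ 2 ≤ C * (energy u.1).toReal := by
  obtain ⟨k, hk⟩ := exists_nat_ge (2 * L)
  obtain ⟨C, hC, h⟩ := exists_lintegral_Ioc_le L k
  -- The summand `1` accounts for the energy term in the graph norm.
  refine ⟨C.toReal + 1, by positivity, fun u => ?_⟩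
  rw [norm_toHilbert_sq, embedding_toHilbert, norm_toLp_sq, add_mul, one_mul,
    ← ENNReal.toReal_mul]
  gcongr
  · exact ENNReal.mul_ne_top hC u.2.energy_lt.ne
  · refine le_trans (lintegral_mono_set fun x hx => ?_) (h u.1 u.2)
    exact ⟨by linarith [hx.1], by linarith [hx.2]⟩

/-! ### Compactness of the embedding into `L²(Ω)` -/

/-- The measure `dy / (y - a + h)` on `(a, a + 1/2]`. -/
noncomputable def weight (a h : ℝ) : Measure ℝ :=
  (volume.restrict (Ioc a (a + 1 / 2))).withDensity fun y => ENNReal.ofReal (y - (a - h))⁻¹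

/-- This mass tends to infinity as `h → 0`: the logarithmic divergence that produces compactness. -/
theorem weight_univ (a : ℝ) {h : ℝ} (hh : 0 < h) :
    weight a h univ = ENNReal.ofReal (Real.log ((1 / 2 + h) / h)) := by
  rw [weight, withDensity_apply _ MeasurableSet.univ, Measure.restrict_univ]
  have hcont : ContinuousOn (fun y : ℝ => (y - (a - h))⁻¹) (uIcc a (a + 1 / 2)) := by
    rw [uIcc_of_le (by linarith)]
    exact ContinuousOn.inv₀ (by fun_prop) fun y hy => by linarith [hy.1]
  have hint := hcont.intervalIntegrable (μ := volume)
  rw [← ofReal_integral_eq_lintegral_ofReal hint.1, ← intervalIntegral.integral_of_le (by linarith),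
    intervalIntegral.integral_comp_sub_right (fun x => x⁻¹) (a - h), integral_inv_of_pos]
  · congr 3 <;> ring
  · linarith
  · linarith
  · filter_upwards [ae_restrict_mem measurableSet_Ioc] with y hy
    exact inv_nonneg.2 (by linarith [hy.1])

theorem integrable_weight {u : ℝ → ℝ} (hu : MemLp u 2 volume) (a : ℝ) {h : ℝ} (hh : 0 < h) :
    Integrable u (weight a h) := by
  have h1 : Integrable u (volume.restrict (Ioc a (a + 1 / 2))) :=
    (hu.restrict _).integrable (by norm_num)
  refine Integrable.mono_measure (h1.smul_measure (c := ENNReal.ofReal h⁻¹) (by simp)) ?_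
  rw [weight, ← withDensity_const]
  refine withDensity_mono ?_
  filter_upwards [ae_restrict_mem measurableSet_Ioc] with y hy
  refine ENNReal.ofReal_le_ofReal (inv_anti₀ hh (by linarith [hy.1]))

/-- The weighted average of `u` to the right of `a` approximates `u` near `a` up to the
logarithmically small energy density. -/
theorem enorm_sub_weightedAverage_le {u : ℝ → ℝ} (hu : MemLp u 2 volume) {a h x : ℝ} (hh : 0 < h)
    (hh' : h ≤ 1 / 2) (hx : x ∈ Ico a (a + h)) :
    ‖u x - (Real.log ((1 / 2 + h) / h))⁻¹ * ∫ y, u y ∂(weight a h)‖ₑ ^ 2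
      ≤ ENNReal.ofReal (Real.log ((1 / 2 + h) / h))⁻¹
        * ∫⁻ y, kernelE (y - x) * ‖u x - u y‖ₑ ^ 2 := by
  set w := Real.log ((1 / 2 + h) / h) with hw
  have hw0 : 0 < w := Real.log_pos (by rw [lt_div_iff₀ hh]; linarith)
  have huniv := weight_univ a hh
  rw [← hw] at huniv
  have : IsFiniteMeasure (weight a h) := ⟨by rw [huniv]; exact ENNReal.ofReal_lt_top⟩
  have hui := integrable_weight hu a hh
  have hint : ∫ y, (u x - u y) ∂(weight a h) = w * u x - ∫ y, u y ∂(weight a h) := by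
    rw [integral_sub (integrable_const _) hui, integral_const, Measure.real, huniv,
      ENNReal.toReal_ofReal hw0.le, smul_eq_mul]
  have hfm : AEStronglyMeasurable (fun y => u x - u y) (weight a h) :=
    ((integrable_const _).sub hui).1
  have key : u x - w⁻¹ * ∫ y, u y ∂(weight a h) = w⁻¹ * ∫ y, (u x - u y) ∂(weight a h) := by
    rw [hint]; field_simp
  have hmeas : AEMeasurable (fun y => ‖u x - u y‖ₑ ^ 2) (volume.restrict (Ioc a (a + 1 / 2))) :=
    ((aemeasurable_const.sub hu.1.aemeasurable).enorm.pow_const 2).restrict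
  have hle : ∫⁻ y, ‖u x - u y‖ₑ ^ 2 ∂(weight a h)
      ≤ ∫⁻ y, kernelE (y - x) * ‖u x - u y‖ₑ ^ 2 := by
    rw [weight, lintegral_withDensity_eq_lintegral_mul₀ (by fun_prop) hmeas]
    refine le_trans ?_ (setLIntegral_le_lintegral (Ioc a (a + 1 / 2)) _)
    refine setLIntegral_mono' measurableSet_Ioc fun y hy => ?_
    simp only [Pi.mul_apply]
    -- On the diagonal `kernelE` is `0` by convention and does not dominate the weight, but the
    -- difference vanishes there.
    by_cases hxy : y = x
    · simp [hxy]
    · gcongr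
      have h1 : 0 < |y - x| := abs_pos.2 (sub_ne_zero.2 hxy)
      -- The shift by `h` puts the weight below `1 / |y - x|` for all `x` of the cell
      -- simultaneously.
      have h2 : |y - x| ≤ y - (a - h) := by
        rw [abs_le]; constructor <;> linarith [hy.1, hy.2, hx.1, hx.2]
      rw [kernelE, indicator_of_mem (by constructor <;> linarith [hy.1, hy.2, hx.1, hx.2])]
      rw [one_div]
      exact ENNReal.ofReal_le_ofReal (inv_anti₀ h1 h2)
  have hcs := enorm_integral_sq_le (weight a h) hfm
  rw [key, enorm_mul, mul_pow]
  -- Cauchy–Schwarz costs the total mass `w`, which leaves `w⁻² · w = w⁻¹`.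
  calc _ ≤ ‖w⁻¹‖ₑ ^ 2 * (ENNReal.ofReal w * ∫⁻ y, kernelE (y - x) * ‖u x - u y‖ₑ ^ 2) := by
        rw [← huniv]; gcongr; exact hcs.trans (by gcongr)
    _ = _ := by
        rw [← mul_assoc, enorm_sq_eq, ← ENNReal.ofReal_mul (by positivity)]
        congr 2
        field_simp

theorem tendsto_log_weight :
    Tendsto (fun h : ℝ => Real.log ((1 / 2 + h) / h)) (𝓝[>] 0) atTop := by
  refine Real.tendsto_log_atTop.comp ?_
  simp only [div_eq_mul_inv]
  refine Tendsto.pos_mul_atTop (C := 1 / 2) (by norm_num) ?_ tendsto_inv_nhdsGT_zero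
  have : Tendsto (fun h : ℝ => 1 * 2⁻¹ + h) (𝓝 0) (𝓝 (1 * 2⁻¹ + 0)) := by
    exact tendsto_const_nhds.add tendsto_id
  rw [add_zero, ← div_eq_mul_inv] at this
  simpa [div_eq_mul_inv] using this.mono_left nhdsWithin_le_nhds

/-- The indicator function of the `i`-th cell of length `h`, as an element of `L²(Ω)`. -/
noncomputable def cellIndicator (L h : ℝ) (i : ℕ) : L2Omega L :=
  indicatorConstLp 2 (measurableSet_Ico : MeasurableSet (Ico ((i : ℝ) * h) (i * h + h)))
    (measure_ne_top _ _) 1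

theorem sum_cellIndicator_ae_eq {h : ℝ} (hh : 0 < h) {n : ℕ} (hn : L ≤ n * h) (c : ℕ → ℝ) :
    (∑ i ∈ Finset.range n, c i • cellIndicator L h i : L2Omega L)
      =ᵐ[volume.restrict (Ioo 0 L)] fun x => c ⌊x / h⌋₊ := by
  have h1 : ∀ᵐ x ∂(volume.restrict (Ioo 0 L)), ∀ i ∈ Finset.range n,
      (c i • cellIndicator L h i : L2Omega L) x
        = c i * (Ico ((i : ℝ) * h) (i * h + h)).indicator (fun _ => 1) x := by
    rw [Filter.eventually_all_finset]
    intro i _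
    filter_upwards [Lp.coeFn_smul (c i) (cellIndicator L h i),
      indicatorConstLp_coeFn (p := 2) (μ := volume.restrict (Ioo 0 L))
        (hs := (measurableSet_Ico : MeasurableSet (Ico ((i : ℝ) * h) (i * h + h))))
        (hμs := measure_ne_top _ _) (c := (1 : ℝ))] with x hx1 hx2
    rw [hx1, Pi.smul_apply, smul_eq_mul, cellIndicator, hx2]
  have h2 := Lp.coeFn_finsetSum (Finset.range n) (fun i => (c i • cellIndicator L h i : L2Omega L))
  filter_upwards [h1, h2, ae_restrict_mem measurableSet_Ioo] with x hx1 hx2 hx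
  rw [hx2, Finset.sum_apply, Finset.sum_congr rfl hx1]
  have hmem : ∀ i : ℕ, x ∈ Ico ((i : ℝ) * h) (i * h + h) ↔ ⌊x / h⌋₊ = i := by
    intro i
    rw [Nat.floor_eq_iff (div_nonneg hx.1.le hh.le), le_div_iff₀ hh, div_lt_iff₀ hh, mem_Ico,
      add_mul, one_mul]
  rw [Finset.sum_eq_single ⌊x / h⌋₊]
  · rw [indicator_of_mem ((hmem _).2 rfl), mul_one]
  · intro i _ hi
    rw [indicator_of_notMem (fun h' => hi ((hmem i).1 h').symm), mul_zero]
  · intro hnot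
    exfalso
    apply hnot
    rw [Finset.mem_range, Nat.floor_lt (div_nonneg hx.1.le hh.le), div_lt_iff₀ hh]
    exact hx.2.trans_le hn

/-- `ℍ(Ω)` is compactly embedded in `L²(Ω)`. -/
theorem isCompactOperator_embedding (L : ℝ) : IsCompactOperator (embedding L) := by
  refine isCompactOperator_of_approx _ fun ε hε => ?_
  -- The cell length is chosen so small that `w⁻¹ ≤ ε²`; step functions of weighted averages on
  -- these cells are then `ε`-close.
  obtain ⟨h, hw, hh, hh'⟩ : ∃ h : ℝ, (ε ^ 2)⁻¹ ≤ Real.log ((1 / 2 + h) / h) ∧ 0 < h ∧ h ≤ 1 / 2 := by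
    have h1 := tendsto_log_weight.eventually_ge_atTop (ε ^ 2)⁻¹
    have h2 : ∀ᶠ h : ℝ in 𝓝[>] 0, h ∈ Ioc (0 : ℝ) (1 / 2) := Ioc_mem_nhdsGT (by norm_num)
    obtain ⟨h, h3, h4, h5⟩ := (h1.and h2).exists
    exact ⟨h, h3, h4, h5⟩
  obtain ⟨n, hn⟩ := exists_nat_ge (L / h)
  rw [div_le_iff₀ hh] at hn
  refine ⟨Submodule.span ℝ (range fun i : Fin n => cellIndicator L h i),
    FiniteDimensional.span_of_finite ℝ (finite_range _), fun z => ?_⟩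
  obtain ⟨u, rfl⟩ := toHilbert_surjective z
  set w := Real.log ((1 / 2 + h) / h) with hwdef
  have hw0 : 0 < w := lt_of_lt_of_le (by positivity) hw
  set c : ℕ → ℝ := fun i => w⁻¹ * ∫ y, u.1 y ∂(weight (i * h) h) with hc
  refine ⟨∑ i ∈ Finset.range n, c i • cellIndicator L h i, ?_, ?_⟩
  · refine Submodule.sum_mem _ fun i hi => Submodule.smul_mem _ _ (Submodule.subset_span ?_)
    exact ⟨⟨i, Finset.mem_range.1 hi⟩, rfl⟩
  set s : L2Omega L := ∑ i ∈ Finset.range n, c i • cellIndicator L h i with hs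
  have hae := sum_cellIndicator_ae_eq hh hn c
  rw [← hs] at hae
  have hbound : ∫⁻ x in Ioo 0 L, ‖u.1 x - s x‖ₑ ^ 2 ≤ ENNReal.ofReal w⁻¹ * energy u.1 := by
    rw [energy_eq_iterated u.2.aemeasurable, ← lintegral_const_mul' _ _ ENNReal.ofReal_ne_top]
    refine le_trans ?_ (setLIntegral_le_lintegral (Ioo 0 L) _)
    refine lintegral_mono_ae ?_
    filter_upwards [hae, ae_restrict_mem measurableSet_Ioo] with x hx hxL
    rw [hx]
    refine enorm_sub_weightedAverage_le u.2.memLp hh hh' ?_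
    have := (Nat.floor_eq_iff (div_nonneg hxL.1.le hh.le)).1 (rfl : ⌊x / h⌋₊ = ⌊x / h⌋₊)
    rw [le_div_iff₀ hh, div_lt_iff₀ hh, add_mul, one_mul] at this
    exact this
  have hnorm : ‖embedding L (toHilbert L u) - s‖ ^ 2
      = (∫⁻ x in Ioo 0 L, ‖u.1 x - s x‖ₑ ^ 2).toReal := by
    have h1 : MemLp (fun x => u.1 x - s x) 2 (volume.restrict (Ioo 0 L)) :=
      (u.2.memLp.restrict _).sub (Lp.memLp s)
    rw [← norm_toLp_sq h1]
    congr 2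
    rw [embedding_toHilbert]
    have := MemLp.toLp_sub (u.2.memLp.restrict (Ioo 0 L)) (Lp.memLp s)
    rw [Lp.toLp_coeFn] at this
    exact this.symm
  have hsq : ‖embedding L (toHilbert L u) - s‖ ^ 2 ≤ (ε * ‖toHilbert L u‖) ^ 2 := by
    rw [hnorm]
    have h1 := ENNReal.toReal_mono (ENNReal.mul_ne_top ENNReal.ofReal_ne_top u.2.energy_lt.ne) hbound
    rw [ENNReal.toReal_mul, ENNReal.toReal_ofReal (by positivity)] at h1
    have h2 : (energy u.1).toReal ≤ ‖toHilbert L u‖ ^ 2 := by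
      rw [norm_toHilbert_sq]; exact le_add_of_nonneg_left (by positivity)
    have h3 : w⁻¹ ≤ ε ^ 2 := by
      rw [inv_le_comm₀ hw0 (by positivity)]; exact hw
    rw [mul_pow]
    exact h1.trans (mul_le_mul h3 h2 ENNReal.toReal_nonneg (by positivity))
  exact le_of_sq_le_sq hsq (by positivity)

/-! ### Energy estimates by translation, and passage to limits in closed subspaces -/

theorem energy_le_of_pointwise {u v w : ℝ → ℝ} {A B : ℝ≥0∞} (hA : A ≠ ∞) (hB : B ≠ ∞)
    (hu : AEMeasurable u)
    (h : ∀ x y, ‖w x - w y‖ₑ ^ 2 ≤ A * ‖u x - u y‖ₑ ^ 2 + B * ‖v x - v y‖ₑ ^ 2) :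
    energy w ≤ A * energy u + B * energy v := by
  calc energy w ≤ ∫⁻ p, (A * ‖diff u p‖ₑ ^ 2 + B * ‖diff v p‖ₑ ^ 2) ∂nu :=
        lintegral_mono fun p => h p.1 p.2
    _ = _ := by
        rw [lintegral_add_left' (((aestronglyMeasurable_diff hu).enorm.pow_const 2).const_mul A),
          lintegral_const_mul' _ _ hA, lintegral_const_mul' _ _ hB]
        rfl

theorem kernelE_mul_le (t : ℝ) (C : ℝ≥0∞) :
    kernelE t * (C * ENNReal.ofReal |t|) ≤ (Ioo (-1) 1).indicator (fun _ => C) t := by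
  unfold kernelE indicator
  split_ifs
  · rw [mul_left_comm, ← ENNReal.ofReal_mul (by positivity)]
    refine mul_le_of_le_one_right zero_le (ENNReal.ofReal_le_one.2 ?_)
    rw [one_div]
    exact inv_mul_le_one
  · simp

/-- The factor `|t|` cancels the kernel, leaving `C` integrated over `(-1, 1)`. -/
theorem energy_le_of_translation {u : ℝ → ℝ} (hu : AEMeasurable u) {C : ℝ≥0∞}
    (h : ∀ t ∈ Ioo (-1 : ℝ) 1, ∫⁻ x, ‖u x - u (x + t)‖ₑ ^ 2 ≤ C * ENNReal.ofReal |t|) :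
    energy u ≤ 2 * C := by
  rw [energy_eq_shear hu]
  calc _ ≤ ∫⁻ t, (Ioo (-1 : ℝ) 1).indicator (fun _ => C) t := by
        refine lintegral_mono fun t => ?_
        by_cases ht : t ∈ Ioo (-1 : ℝ) 1
        · exact (mul_le_mul' le_rfl (h t ht)).trans (kernelE_mul_le t C)
        · simp [kernelE, indicator_of_notMem ht]
    _ = 2 * C := by
        rw [lintegral_indicator_const measurableSet_Ioo, Real.volume_Ioo, mul_comm]
        norm_num

theorem lintegral_indicator_Ioi_translation (a t : ℝ) :
    ∫⁻ x, ‖(Ioi a).indicator (fun _ => (1 : ℝ)) x - (Ioi a).indicator (fun _ => 1) (x + t)‖ₑ ^ 2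
      ≤ ENNReal.ofReal |t| := by
  calc _ ≤ ∫⁻ x, (uIoc (a - t) a).indicator (fun _ => (1 : ℝ≥0∞)) x := by
        refine lintegral_mono fun x => ?_
        simp only [indicator, mem_Ioi, mem_uIoc]
        split_ifs with h1 h2 h3 h3 h2 h3 h3 <;> simp <;> grind
    _ = _ := by
        rw [lintegral_indicator_const measurableSet_uIoc, one_mul, uIoc, Real.volume_Ioc]
        congr 1
        rw [max_sub_min_eq_abs]
        congr 1; ring

theorem measurable_indicator_Ioi (a : ℝ) : Measurable ((Ioi a).indicator fun _ => (1 : ℝ)) :=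
  measurable_const.indicator measurableSet_Ioi

/-- A jump has finite energy, with a bound independent of its position. Cutoffs therefore cost
bounded energy, and functions jumping at the ends of `Ω` can belong to `ℍ(Ω)`. -/
theorem energy_indicator_Ioi_le (a : ℝ) : energy ((Ioi a).indicator fun _ => (1 : ℝ)) ≤ 2 := by
  have := energy_le_of_translation (C := 1) (measurable_indicator_Ioi a).aemeasurable fun t _ => by
    rw [one_mul]; exact lintegral_indicator_Ioi_translation a t
  simpa using this

theorem tendsto_embedding {u : functionSpace L} {v : ℕ → functionSpace L} {G : ℝ → ℝ}
    (hG : MemLp G 2 (volume.restrict (Ioo 0 L))) (hbound : ∀ n x, |(v n).1 x - u.1 x| ≤ G x)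
    (hlim : ∀ᵐ x, Tendsto (fun n => (v n).1 x) atTop (𝓝 (u.1 x))) :
    Tendsto (fun n => embedding L (toHilbert L (v n))) atTop (𝓝 (embedding L (toHilbert L u))) := by
  rw [tendsto_iff_norm_sub_tendsto_zero]
  have hsq : ∀ n, ‖embedding L (toHilbert L (v n)) - embedding L (toHilbert L u)‖
      = √((∫⁻ x in Ioo 0 L, ‖(v n).1 x - u.1 x‖ₑ ^ 2).toReal) := by
    intro n
    rw [embedding_toHilbert, embedding_toHilbert, ← MemLp.toLp_sub]
    rw [← Real.sqrt_sq (norm_nonneg _), norm_toLp_sq]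
    rfl
  simp only [hsq]
  have key : Tendsto (fun n => ∫⁻ x in Ioo 0 L, ‖(v n).1 x - u.1 x‖ₑ ^ 2) atTop
      (𝓝 (∫⁻ _ in Ioo 0 L, (0 : ℝ≥0∞))) := by
    refine tendsto_lintegral_of_dominated_convergence' (fun x => ‖G x‖ₑ ^ 2) (fun n => ?_)
      (fun n => Eventually.of_forall fun x => ?_) (memLp_two_iff.1 hG).2.ne ?_
    · exact (((v n).2.aemeasurable.sub u.2.aemeasurable).enorm.pow_const 2).restrict
    · refine pow_le_pow_left' ?_ 2
      rw [enorm_le_iff_norm_le, Real.norm_eq_abs, Real.norm_eq_abs]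
      exact (hbound n x).trans (le_abs_self _)
    · filter_upwards [ae_restrict_of_ae hlim] with x hx
      have h1 : Tendsto (fun n => ‖(v n).1 x - u.1 x‖ₑ ^ 2) atTop (𝓝 (‖u.1 x - u.1 x‖ₑ ^ 2)) := by
        have h2 : Continuous fun y : ℝ => ‖y - u.1 x‖ₑ ^ 2 := by fun_prop
        exact (h2.tendsto _).comp hx
      simpa using h1
  rw [lintegral_zero] at key
  have h3 := ((ENNReal.tendsto_toReal ENNReal.zero_ne_top).comp key).sqrt
  simpa using h3

/-- Bounded energy and dominated convergence suffice to stay in a closed subspace. -/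
theorem toHilbert_mem_of_tendsto {D : Submodule ℝ (hilbertSpace L)}
    (hD : IsClosed (D : Set (hilbertSpace L))) {u : functionSpace L} {v : ℕ → functionSpace L}
    (hv : ∀ n, toHilbert L (v n) ∈ D) {C : ℝ≥0∞} (hC : C ≠ ∞) (henergy : ∀ n, energy (v n).1 ≤ C)
    {G : ℝ → ℝ} (hG : MemLp G 2 (volume.restrict (Ioo 0 L)))
    (hbound : ∀ n x, |(v n).1 x - u.1 x| ≤ G x)
    (hlim : ∀ᵐ x, Tendsto (fun n => (v n).1 x) atTop (𝓝 (u.1 x))) : toHilbert L u ∈ D := by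
  obtain ⟨P, hP, hPu⟩ := exists_poincare L
  refine mem_of_bounded_of_tendsto embedding_injective D hD hv (C := √(P * C.toReal))
    (fun n => ?_) (tendsto_embedding hG hbound hlim)
  refine Real.le_sqrt_of_sq_le ((hPu (v n)).trans ?_)
  gcongr
  exact henergy n

theorem MemH.integrable {u : ℝ → ℝ} (hu : MemH L u) : Integrable u := by
  have h1 : IntegrableOn u (Ioo 0 L) := (hu.memLp.restrict _).integrable (by norm_num)
  refine (integrableOn_iff_integrable_of_support_subset fun x hx => ?_).1 h1
  by_contra h
  exact hx (hu.eq_zero x h)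

/-! ### Regularization by forward averages -/

/-- The average of `u` over `(x, x + δ)`. -/
noncomputable def forwardAverage (δ : ℝ) (u : ℝ → ℝ) (x : ℝ) : ℝ := δ⁻¹ * ∫ y in x..(x + δ), u y

theorem forwardAverage_eq {δ : ℝ} (hδ : 0 < δ) (u : ℝ → ℝ) (x : ℝ) :
    forwardAverage δ u x = δ⁻¹ * ∫ s in Ioc 0 δ, u (x + s) := by
  rw [forwardAverage, ← intervalIntegral.integral_of_le hδ.le,
    intervalIntegral.integral_comp_add_left u x, add_zero]

theorem lipschitzWith_forwardAverage {u : ℝ → ℝ} (hu : Integrable u) {M : ℝ}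
    (hM : ∀ x, |u x| ≤ M) {δ : ℝ} (hδ : 0 < δ) :
    ∃ K : ℝ≥0, LipschitzWith K (forwardAverage δ u) := by
  have hM0 : 0 ≤ M := (abs_nonneg _).trans (hM 0)
  refine ⟨(δ⁻¹ * (2 * M)).toNNReal, LipschitzWith.of_dist_le_mul fun x y => ?_⟩
  have hi : ∀ a b, IntervalIntegrable u volume a b := fun a b => hu.intervalIntegrable
  have e : (∫ z in x..(x + δ), u z) - ∫ z in y..(y + δ), u z
      = (∫ z in (y + δ)..(x + δ), u z) - ∫ z in y..x, u z := by
    have h1 := intervalIntegral.integral_add_adjacent_intervals (hi y x) (hi x (x + δ))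
    have h2 := intervalIntegral.integral_add_adjacent_intervals (hi y (y + δ)) (hi (y + δ) (x + δ))
    linarith
  have h1 : ‖∫ z in (y + δ)..(x + δ), u z‖ ≤ M * |x + δ - (y + δ)| :=
    intervalIntegral.norm_integral_le_of_norm_le_const fun z _ => hM z
  have h2 : ‖∫ z in y..x, u z‖ ≤ M * |x - y| :=
    intervalIntegral.norm_integral_le_of_norm_le_const fun z _ => hM z
  rw [add_sub_add_right_eq_sub] at h1
  rw [Real.dist_eq, forwardAverage, forwardAverage, ← mul_sub, e, abs_mul, abs_of_pos
    (inv_pos.2 hδ), Real.dist_eq, Real.coe_toNNReal _ (by positivity), mul_assoc]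
  gcongr
  calc _ ≤ _ := norm_sub_le (∫ z in (y + δ)..(x + δ), u z) (∫ z in y..x, u z)
    _ ≤ _ := by linarith

theorem abs_forwardAverage_le {u : ℝ → ℝ} {M : ℝ} (hM : ∀ x, |u x| ≤ M) {δ : ℝ} (hδ : 0 < δ)
    (x : ℝ) : |forwardAverage δ u x| ≤ M := by
  have h2 : ‖∫ z in x..(x + δ), u z‖ ≤ M * |x + δ - x| :=
    intervalIntegral.norm_integral_le_of_norm_le_const fun z _ => hM z
  rw [add_sub_cancel_left, abs_of_pos hδ, Real.norm_eq_abs] at h2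
  rw [forwardAverage, abs_mul, abs_of_pos (inv_pos.2 hδ), inv_mul_le_iff₀ hδ]
  linarith

/-- The average looks only to the right, so supports spread only to the left and a gap of width `δ`
is needed at the left end alone. -/
theorem forwardAverage_eq_zero {u : ℝ → ℝ} {δ : ℝ} (hδ : 0 < δ)
    (hu : ∀ x, x ∉ Ioo δ L → u x = 0) (x : ℝ) (hx : x ∉ Ioo 0 L) : forwardAverage δ u x = 0 := by
  rw [forwardAverage_eq hδ, setIntegral_eq_zero_of_forall_eq_zero, mul_zero]
  intro s hs
  refine hu _ fun h => hx ⟨?_, ?_⟩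
  · linarith [h.1, hs.2]
  · linarith [h.2, hs.1]

/-- Averaging commutes with translation; Cauchy–Schwarz on `(0, δ]` and translation invariance make
it an `L²` contraction. -/
theorem lintegral_translation_forwardAverage_le {u : ℝ → ℝ} (hu : Integrable u) {δ : ℝ}
    (hδ : 0 < δ) (t : ℝ) :
    ∫⁻ x, ‖forwardAverage δ u x - forwardAverage δ u (x + t)‖ₑ ^ 2
      ≤ ∫⁻ x, ‖u x - u (x + t)‖ₑ ^ 2 := by
  set F : ℝ → ℝ := fun x => u x - u (x + t) with hF
  have hFi : Integrable F := hu.sub (hu.comp_add_right t)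
  have hpt : ∀ x, ‖forwardAverage δ u x - forwardAverage δ u (x + t)‖ₑ ^ 2
      ≤ ENNReal.ofReal δ⁻¹ * ∫⁻ s in Ioc 0 δ, ‖F (x + s)‖ₑ ^ 2 := by
    intro x
    have e : forwardAverage δ u x - forwardAverage δ u (x + t)
        = δ⁻¹ * ∫ s in Ioc 0 δ, F (x + s) := by
      rw [forwardAverage_eq hδ, forwardAverage_eq hδ, ← mul_sub, ← integral_sub]
      · congr 1
        refine integral_congr_ae (Eventually.of_forall fun s => ?_)
        simp only [hF]
        congr 2; ring
      · exact (hu.comp_add_left x).integrableOn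
      · exact (hu.comp_add_left (x + t)).integrableOn
    have hcs := enorm_integral_sq_le (volume.restrict (Ioc 0 δ))
      (hFi.comp_add_left x).integrableOn.1
    rw [e, enorm_mul, mul_pow]
    calc _ ≤ ‖δ⁻¹‖ₑ ^ 2 * ((volume.restrict (Ioc 0 δ)) univ * ∫⁻ s in Ioc 0 δ, ‖F (x + s)‖ₑ ^ 2) := by
          gcongr
      _ = _ := by
          rw [← mul_assoc, enorm_sq_eq, Measure.restrict_apply_univ, Real.volume_Ioc, sub_zero,
            ← ENNReal.ofReal_mul (by positivity)]
          congr 2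
          field_simp
  have hmeas : AEMeasurable (Function.uncurry fun x s => ‖F (x + s)‖ₑ ^ 2)
      ((volume : Measure ℝ).prod (volume.restrict (Ioc 0 δ))) := by
    have hmp : MeasurePreserving (fun z : ℝ × ℝ => (z.1, z.1 + z.2))
        ((volume : Measure ℝ).prod volume) ((volume : Measure ℝ).prod volume) :=
      measurePreserving_prod_add volume volume
    have h1 := (hFi.1.aemeasurable.enorm.pow_const 2).comp_quasiMeasurePreserving
      (Measure.quasiMeasurePreserving_snd.comp hmp.quasiMeasurePreserving)
    have h2 : ((volume : Measure ℝ).prod (volume.restrict (Ioc 0 δ)))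
        = ((volume : Measure ℝ).prod volume).restrict (univ ×ˢ Ioc 0 δ) := by
      rw [← Measure.prod_restrict, Measure.restrict_univ]
    rw [h2]
    exact h1.restrict
  calc _ ≤ ∫⁻ x, ENNReal.ofReal δ⁻¹ * ∫⁻ s in Ioc 0 δ, ‖F (x + s)‖ₑ ^ 2 := lintegral_mono hpt
    _ = ENNReal.ofReal δ⁻¹ * ∫⁻ s in Ioc 0 δ, ∫⁻ x, ‖F (x + s)‖ₑ ^ 2 := by
        rw [lintegral_const_mul' _ _ ENNReal.ofReal_ne_top, lintegral_lintegral_swap hmeas]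
    _ = ENNReal.ofReal δ⁻¹ * ∫⁻ s in Ioc 0 δ, ∫⁻ x, ‖F x‖ₑ ^ 2 := by
        congr 1
        refine lintegral_congr fun s => ?_
        exact lintegral_add_right_eq_self (fun x => ‖F x‖ₑ ^ 2) s
    _ = _ := by
        rw [setLIntegral_const, Real.volume_Ioc, sub_zero, mul_comm _ (ENNReal.ofReal δ), ← mul_assoc,
          ← ENNReal.ofReal_mul (by positivity), inv_mul_cancel₀ hδ.ne', ENNReal.ofReal_one, one_mul]

theorem energy_forwardAverage_le {u : ℝ → ℝ} (hu : Integrable u) {M : ℝ}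
    (hM : ∀ x, |u x| ≤ M) {δ : ℝ} (hδ : 0 < δ) : energy (forwardAverage δ u) ≤ energy u := by
  obtain ⟨K, hK⟩ := lipschitzWith_forwardAverage hu hM hδ
  rw [energy_eq_shear hu.1.aemeasurable, energy_eq_shear hK.continuous.aemeasurable]
  refine lintegral_mono fun t => ?_
  exact mul_le_mul' le_rfl (lintegral_translation_forwardAverage_le hu hδ t)

theorem memLp_of_bounded {u : ℝ → ℝ} (hu : AEMeasurable u) {M : ℝ} (hM : ∀ x, |u x| ≤ M)
    (h0 : ∀ x, x ∉ Ioo 0 L → u x = 0) : MemLp u 2 volume := by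
  have h1 : MemLp u 2 (volume.restrict (Ioo 0 L)) :=
    MemLp.of_bound hu.restrict.aestronglyMeasurable M (Eventually.of_forall hM)
  rw [← memLp_indicator_iff_restrict measurableSet_Ioo] at h1
  have : (Ioo 0 L).indicator u = u := indicator_eq_self.2 fun x hx => by
    by_contra h
    exact hx (h0 x h)
  rwa [this] at h1

theorem memH_forwardAverage {u : ℝ → ℝ} (hu : MemH L u) {M : ℝ} (hM : ∀ x, |u x| ≤ M) {δ : ℝ}
    (hδ : 0 < δ) (h0 : ∀ x, x ∉ Ioo δ L → u x = 0) : MemH L (forwardAverage δ u) := by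
  obtain ⟨K, hK⟩ := lipschitzWith_forwardAverage hu.integrable hM hδ
  refine memH_iff.2 ⟨?_, forwardAverage_eq_zero hδ h0,
    (energy_forwardAverage_le hu.integrable hM hδ).trans_lt hu.energy_lt⟩
  exact memLp_of_bounded hK.continuous.aemeasurable (abs_forwardAverage_le hM hδ)
    (forwardAverage_eq_zero hδ h0)

theorem ae_tendsto_forwardAverage {u : ℝ → ℝ} (hu : Integrable u) {δ : ℕ → ℝ}
    (hδ : ∀ n, 0 < δ n) (hlim : Tendsto δ atTop (𝓝 0)) :
    ∀ᵐ x, Tendsto (fun n => forwardAverage (δ n) u x) atTop (𝓝 (u x)) := by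
  filter_upwards [LocallyIntegrable.ae_hasDerivAt_integral hu.locallyIntegrable] with x hx
  have h1 := (hx x).tendsto_slope_zero
  have h2 : Tendsto δ atTop (𝓝[≠] 0) :=
    tendsto_nhdsWithin_iff.2 ⟨hlim, Eventually.of_forall fun n => (hδ n).ne'⟩
  refine (h1.comp h2).congr fun n => ?_
  simp [forwardAverage]

/-! ### Density of Lipschitz functions, tested on a closed subspace `D` containing them -/

section Density

variable {D : Submodule ℝ (hilbertSpace L)} (hD : IsClosed (D : Set (hilbertSpace L)))
  (hLip : ∀ u : functionSpace L, (∃ K : ℝ≥0, LipschitzWith K u.1) → toHilbert L u ∈ D)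

include hD hLip

/-- Forward averages at scales `a / (n + 1) ≤ a` are Lipschitz, still vanish outside `Ω` and do not
increase the energy. -/
theorem mem_of_bounded_of_support {a M : ℝ} (ha : 0 < a) (u : functionSpace L)
    (hM : ∀ x, |u.1 x| ≤ M) (h0 : ∀ x, x ∉ Ioo a L → u.1 x = 0) : toHilbert L u ∈ D := by
  have hδ : ∀ n : ℕ, 0 < a * (1 / ((n : ℝ) + 1)) := fun n => by positivity
  have h0' : ∀ n : ℕ, ∀ x, x ∉ Ioo (a * (1 / ((n : ℝ) + 1))) L → u.1 x = 0 := by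
    intro n x hx
    refine h0 x fun h => hx ⟨lt_of_le_of_lt ?_ h.1, h.2⟩
    refine mul_le_of_le_one_right ha.le ?_
    rw [div_le_one (by positivity)]
    linarith [(Nat.cast_nonneg n : (0 : ℝ) ≤ n)]
  refine toHilbert_mem_of_tendsto hD
    (v := fun n => ⟨_, memH_forwardAverage u.2 hM (hδ n) (h0' n)⟩)
    (fun n => hLip _ (lipschitzWith_forwardAverage u.2.integrable hM (hδ n)))
    u.2.energy_lt.ne (fun n => energy_forwardAverage_le u.2.integrable hM (hδ n))
    (G := fun _ => M + M) (memLp_const _) (fun n x => ?_) ?_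
  · exact (abs_sub _ _).trans (add_le_add (abs_forwardAverage_le hM (hδ n) x) (hM x))
  · refine ae_tendsto_forwardAverage u.2.integrable hδ ?_
    simpa using tendsto_one_div_add_atTop_nhds_zero_nat.const_mul a

/-- Cutting `u` off to the left of `1 / (n + 1)` opens the gap needed for averaging. The new jump
costs at most a fixed multiple of `M²`, so the energies stay bounded, which is enough for membership
of the limit. -/
theorem mem_of_bounded {M : ℝ} (u : functionSpace L) (hM : ∀ x, |u.1 x| ≤ M) :
    toHilbert L u ∈ D := by
  have hM0 : 0 ≤ M := (abs_nonneg _).trans (hM 0)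
  set a : ℕ → ℝ := fun n => 1 / ((n : ℝ) + 1) with ha
  have ha0 : ∀ n, 0 < a n := fun n => by positivity
  set v : ℕ → ℝ → ℝ := fun n => (Ioi (a n)).indicator u.1 with hv
  have hvM : ∀ n x, |v n x| ≤ M := by
    intro n x
    simp only [hv, indicator]
    split_ifs
    · exact hM x
    · simpa using hM0
  have hv0 : ∀ n x, x ∉ Ioo (a n) L → v n x = 0 := by
    intro n x hx
    simp only [hv, indicator, mem_Ioi]
    split_ifs with h
    · exact u.2.eq_zero x fun h' => hx ⟨h, h'.2⟩
    · rfl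
  have hvm : ∀ n, AEMeasurable (v n) := fun n => u.2.aemeasurable.indicator measurableSet_Ioi
  have henergy : ∀ n, energy (v n) ≤ 2 * energy u.1 + ENNReal.ofReal (2 * M ^ 2) * 2 := by
    intro n
    refine (energy_le_of_pointwise (A := 2) (B := ENNReal.ofReal (2 * M ^ 2)) (by simp)
      ENNReal.ofReal_ne_top
      u.2.aemeasurable (v := (Ioi (a n)).indicator fun _ => 1) fun x y => ?_).trans ?_
    · simp only [enorm_sq_eq]
      rw [← ENNReal.ofReal_ofNat 2, ← ENNReal.ofReal_mul (by norm_num), ← ENNReal.ofReal_mul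
        (by positivity), ← ENNReal.ofReal_add (by positivity) (by positivity)]
      apply ENNReal.ofReal_le_ofReal
      have hx : u.1 x ^ 2 ≤ M ^ 2 := sq_le_sq' (abs_le.1 (hM x)).1 (abs_le.1 (hM x)).2
      have hy : u.1 y ^ 2 ≤ M ^ 2 := sq_le_sq' (abs_le.1 (hM y)).1 (abs_le.1 (hM y)).2
      simp only [hv, indicator]
      split_ifs <;> nlinarith [sq_nonneg (u.1 x - u.1 y)]
    · gcongr
      exact energy_indicator_Ioi_le _
  have hfin : 2 * energy u.1 + ENNReal.ofReal (2 * M ^ 2) * 2 ≠ ∞ := by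
    have := u.2.energy_lt.ne
    finiteness
  have hvH : ∀ n, MemH L (v n) := fun n => by
    have h0 : ∀ x, x ∉ Ioo 0 L → v n x = 0 := fun x hx =>
      hv0 n x fun h => hx ⟨(ha0 n).trans h.1, h.2⟩
    exact memH_iff.2 ⟨memLp_of_bounded (hvm n) (hvM n) h0, h0, (henergy n).trans_lt hfin.lt_top⟩
  refine toHilbert_mem_of_tendsto hD (v := fun n => ⟨v n, hvH n⟩)
    (fun n => mem_of_bounded_of_support hD hLip (ha0 n) _ (hvM n) (hv0 n)) hfin henergy
    (G := fun _ => M + M) (memLp_const _)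
    (fun n x => (abs_sub _ _).trans (add_le_add (hvM n x) (hM x)))
    (Eventually.of_forall fun x => ?_)
  by_cases hx : 0 < x
  · have h1 : ∀ᶠ n in atTop, a n < x :=
      tendsto_one_div_add_atTop_nhds_zero_nat.eventually_lt_const hx
    refine tendsto_const_nhds.congr' ?_
    filter_upwards [h1] with n hn
    simp only [hv]
    rw [indicator_of_mem (mem_Ioi.2 hn)]
  · have h1 : u.1 x = 0 := u.2.eq_zero x fun h => hx h.1
    refine tendsto_const_nhds.congr fun n => ?_
    simp only [hv, indicator]
    split_ifs <;> simp [h1]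

/-- Lipschitz functions vanishing outside `Ω` are dense in `ℍ(Ω)`. -/
theorem mem_of_lipschitz_mem (z : hilbertSpace L) : z ∈ D := by
  obtain ⟨u, rfl⟩ := toHilbert_surjective z
  -- Truncation at `±n` is 1-Lipschitz in the values, so it does not increase the energy.
  set v : ℕ → ℝ → ℝ := fun n x => max (-(n : ℝ)) (min (u.1 x) n) with hv
  have hvabs : ∀ n x, |v n x| ≤ n := fun n x => by
    have hn : (0 : ℝ) ≤ n := Nat.cast_nonneg n
    rw [abs_le]
    exact ⟨le_max_left _ _, max_le (by linarith) (min_le_right _ _)⟩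
  have hv0 : ∀ n x, x ∉ Ioo 0 L → v n x = 0 := fun n x hx => by
    have hn : (0 : ℝ) ≤ n := Nat.cast_nonneg n
    simp [hv, u.2.eq_zero x hx]
  have hdiff : ∀ n x y, |v n x - v n y| ≤ |u.1 x - u.1 y| := fun n x y => by
    refine (abs_max_sub_max_le_max _ _ _ _).trans ?_
    rw [sub_self, abs_zero, max_eq_right (abs_nonneg _)]
    refine (abs_min_sub_min_le_max _ _ _ _).trans ?_
    rw [sub_self, abs_zero, max_eq_left (abs_nonneg _)]
  have hvm : ∀ n, AEMeasurable (v n) := fun n =>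
    aemeasurable_const.max (u.2.aemeasurable.min aemeasurable_const)
  have henergy : ∀ n, energy (v n) ≤ energy u.1 := fun n => by
    refine lintegral_mono fun p => ?_
    gcongr
    rw [enorm_le_iff_norm_le]
    exact hdiff n p.1 p.2
  have hvH : ∀ n, MemH L (v n) := fun n => memH_iff.2
    ⟨memLp_of_bounded (hvm n) (hvabs n) (hv0 n), hv0 n, (henergy n).trans_lt u.2.energy_lt⟩
  have hev : ∀ x, ∀ᶠ n : ℕ in atTop, v n x = u.1 x := fun x => by
    filter_upwards [eventually_ge_atTop ⌈|u.1 x|⌉₊] with n hn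
    have h1 := abs_le.1 (Nat.ceil_le.1 hn)
    simp only [hv]
    rw [min_eq_left h1.2, max_eq_right h1.1]
  refine toHilbert_mem_of_tendsto hD (v := fun n => ⟨v n, hvH n⟩)
    (fun n => mem_of_bounded hD hLip _ (hvabs n)) u.2.energy_lt.ne henergy
    (G := fun x => |u.1 x| + |u.1 x|) ((u.2.memLp.restrict _).abs.add (u.2.memLp.restrict _).abs)
    (fun n x => ?_) (Eventually.of_forall fun x => ?_)
  · refine (abs_sub _ _).trans (add_le_add ?_ le_rfl)
    -- All functions vanish at `-1`, so the contraction property compared with this point gives `|v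
    -- n x| ≤ |u x|`.
    have h1 : |v n x - v n (-1)| ≤ |u.1 x - u.1 (-1)| := hdiff n x (-1)
    have h2 : (-1 : ℝ) ∉ Ioo 0 L := fun h => by linarith [h.1]
    rwa [hv0 n _ h2, u.2.eq_zero _ h2, sub_zero, sub_zero] at h1
  · exact tendsto_const_nhds.congr' ((hev x).mono fun n hn => hn.symm)

end Density

/-- The square is bounded by the sup bound `2 η` times the Lipschitz bound `K |t|`, on a set of
measure at most `2 L`. Uniform convergence with bounded Lipschitz constants thus gives convergence
in energy, without any convergence of derivatives. -/
theorem energy_le_of_lipschitz (hL : 0 < L) {e : ℝ → ℝ} {K : ℝ≥0} (hK : LipschitzWith K e) {η : ℝ}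
    (hη : ∀ x, |e x| ≤ η) (h0 : ∀ x, x ∉ Ioo 0 L → e x = 0) :
    energy e ≤ 2 * ENNReal.ofReal (4 * η * K * L) := by
  have hη0 : 0 ≤ η := (abs_nonneg _).trans (hη 0)
  refine energy_le_of_translation hK.continuous.aemeasurable fun t _ => ?_
  set χ : ℝ → ℝ≥0∞ := (Ioo 0 L).indicator fun _ => ENNReal.ofReal (2 * η * (K * |t|)) with hχ
  have hχm : Measurable χ := measurable_const.indicator measurableSet_Ioo
  have hχi : ∫⁻ x, χ x = ENNReal.ofReal (2 * η * (K * |t|)) * ENNReal.ofReal L := by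
    rw [hχ, lintegral_indicator_const measurableSet_Ioo, Real.volume_Ioo, sub_zero]
  calc _ ≤ ∫⁻ x, (χ x + χ (x + t)) := by
        refine lintegral_mono fun x => ?_
        by_cases hx : x ∈ Ioo 0 L ∨ x + t ∈ Ioo 0 L
        · have h1 : ‖e x - e (x + t)‖ₑ ^ 2 ≤ ENNReal.ofReal (2 * η * (K * |t|)) := by
            rw [enorm_sq_eq]
            refine ENNReal.ofReal_le_ofReal ?_
            have h2 : |e x - e (x + t)| ≤ K * |t| := by
              have := hK.dist_le_mul x (x + t)
              rwa [Real.dist_eq, Real.dist_eq, sub_add_cancel_left, abs_neg] at this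
            have h3 : |e x - e (x + t)| ≤ 2 * η :=
              (abs_sub _ _).trans (by linarith [hη x, hη (x + t)])
            rw [← sq_abs, pow_two]
            exact mul_le_mul h3 h2 (abs_nonneg _) (by positivity)
          rcases hx with hx | hx
          · refine le_add_right (h1.trans_eq ?_)
            rw [hχ, indicator_of_mem hx]
          · refine le_add_left (h1.trans_eq ?_)
            rw [hχ, indicator_of_mem hx]
        · rw [not_or] at hx
          simp [h0 _ hx.1, h0 _ hx.2]
    _ = ENNReal.ofReal (2 * η * (K * |t|)) * ENNReal.ofReal L
        + ENNReal.ofReal (2 * η * (K * |t|)) * ENNReal.ofReal L := by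
        rw [lintegral_add_left hχm, lintegral_add_right_eq_self χ t, hχi]
    _ = _ := by
        rw [← ENNReal.ofReal_mul (by positivity), ← ENNReal.ofReal_mul (by positivity),
          ← ENNReal.ofReal_add (by positivity) (by positivity)]
        congr 1; ring

/-! ### Piecewise affine interpolation of Lipschitz functions -/

section Interpolation

variable (h : ℝ) (φ : ℝ → ℝ)

/-- The slope of the piecewise affine interpolant of `φ` on the grid `h ℤ`. -/
noncomputable def interpolantSlope (x : ℝ) : ℝ :=
  (φ ((⌊x / h⌋ + 1) * h) - φ (⌊x / h⌋ * h)) / h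

/-- The piecewise affine interpolant of `φ` on the grid `h ℤ`, for `φ 0 = 0`. -/
noncomputable def interpolant (x : ℝ) : ℝ := ∫ t in (0 : ℝ)..x, interpolantSlope h φ t

variable {h φ} {K : ℝ≥0} (hh : 0 < h) (hK : LipschitzWith K φ)

include hh in
theorem interpolantSlope_eq {i : ℤ} {x : ℝ} (hx : x ∈ Ico (i * h) ((i + 1) * h)) :
    interpolantSlope h φ x = (φ ((i + 1) * h) - φ (i * h)) / h := by
  have : ⌊x / h⌋ = i := by
    rw [Int.floor_eq_iff, le_div_iff₀ hh, div_lt_iff₀ hh]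
    exact hx
  rw [interpolantSlope, this]

include hh hK

theorem abs_interpolantSlope_le (x : ℝ) : |interpolantSlope h φ x| ≤ K := by
  rw [interpolantSlope, abs_div, abs_of_pos hh, div_le_iff₀ hh]
  have := hK.dist_le_mul ((⌊x / h⌋ + 1) * h) (⌊x / h⌋ * h)
  rw [Real.dist_eq, Real.dist_eq, ← sub_mul, add_sub_cancel_left, one_mul, abs_of_pos hh] at this
  exact this

theorem intervalIntegrable_interpolantSlope (a b : ℝ) :
    IntervalIntegrable (interpolantSlope h φ) volume a b := by
  have hc : Continuous φ := hK.continuous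
  have hm : Measurable (interpolantSlope h φ) := by
    unfold interpolantSlope
    have h1 : Measurable fun x : ℝ => ((⌊x / h⌋ : ℤ) : ℝ) :=
      (measurable_from_top (f := fun n : ℤ => (n : ℝ))).comp
        (Int.measurable_floor.comp (measurable_id.div_const h))
    exact ((hc.measurable.comp ((h1.add_const 1).mul_const h)).sub
      (hc.measurable.comp (h1.mul_const h))).div_const h
  refine (intervalIntegrable_const (c := (K : ℝ))).mono_fun hm.aestronglyMeasurable
    (Eventually.of_forall fun x => ?_)
  simp only [Real.norm_eq_abs, NNReal.abs_eq]
  exact abs_interpolantSlope_le hh hK x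

theorem interpolant_sub (x y : ℝ) :
    interpolant h φ y - interpolant h φ x = ∫ t in x..y, interpolantSlope h φ t :=
  intervalIntegral.integral_interval_sub_left (intervalIntegrable_interpolantSlope hh hK _ _)
    (intervalIntegrable_interpolantSlope hh hK _ _)

/-- Being an integral of slopes bounded by `K`, the interpolant keeps the Lipschitz constant of `φ`
for every mesh size. -/
theorem lipschitzWith_interpolant : LipschitzWith K (interpolant h φ) := by
  refine LipschitzWith.of_dist_le_mul fun x y => ?_
  rw [dist_comm, Real.dist_eq, interpolant_sub hh hK, ← Real.norm_eq_abs, dist_comm, Real.dist_eq]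
  exact intervalIntegral.norm_integral_le_of_norm_le_const (f := interpolantSlope h φ) fun z _ =>
    abs_interpolantSlope_le hh hK z

theorem interpolant_cell {i : ℤ} {x : ℝ} (hx : x ∈ Icc (i * h) ((i + 1) * h)) :
    interpolant h φ x = interpolant h φ (i * h)
      + (φ ((i + 1) * h) - φ (i * h)) / h * (x - i * h) := by
  rw [← sub_eq_iff_eq_add', interpolant_sub hh hK, intervalIntegral.integral_of_le hx.1,
    integral_Ioc_eq_integral_Ioo, setIntegral_congr_fun measurableSet_Ioo
      (g := fun _ => (φ ((i + 1) * h) - φ (i * h)) / h)]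
  · rw [setIntegral_const, Real.volume_real_Ioo_of_le hx.1, smul_eq_mul, mul_comm]
  · intro t ht
    exact interpolantSlope_eq hh ⟨ht.1.le, ht.2.trans_le hx.2⟩

theorem interpolant_node (h0 : φ 0 = 0) (i : ℕ) : interpolant h φ (i * h) = φ (i * h) := by
  induction i with
  | zero => simp [interpolant, h0]
  | succ i ih =>
    have h1 := interpolant_cell hh hK (i := i) (x := ((i : ℤ) + 1 : ℝ) * h)
      ⟨by push_cast; nlinarith, le_rfl⟩
    push_cast at h1 ⊢
    rw [h1, ih]
    field_simp
    ring

/-- Both `0` and `L = (N + 1) h` are nodes, so a cell outside `Ω` has both end points outside `Ω`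
and slope zero. -/
theorem interpolant_eq_zero {N : ℕ} (hN : (N + 1) * h = L) (h0 : ∀ x, x ∉ Ioo 0 L → φ x = 0)
    {x : ℝ} (hx : x ∉ Ioo 0 L) : interpolant h φ x = 0 := by
  rcases le_or_gt x 0 with hx0 | hx0
  · rw [interpolant, intervalIntegral.integral_symm, intervalIntegral.integral_of_le hx0,
      integral_Ioc_eq_integral_Ioo, setIntegral_eq_zero_of_forall_eq_zero, neg_zero]
    intro t ht
    have h1 : (⌊t / h⌋ : ℝ) + 1 ≤ 0 := by
      have : ⌊t / h⌋ < 0 := by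
        rw [Int.floor_lt, Int.cast_zero]
        exact div_neg_of_neg_of_pos ht.2 hh
      exact_mod_cast this
    rw [interpolantSlope, h0 _ fun h' => by nlinarith [h'.1], h0 _ fun h' => by nlinarith [h'.1]]
    simp
  · have hxL : L ≤ x := by
      by_contra h'
      exact hx ⟨hx0, not_le.1 h'⟩
    have h1 : interpolant h φ L = 0 := by
      have := interpolant_node hh hK (h0 0 (by simp)) (N + 1)
      push_cast at this
      rw [hN] at this
      rw [this, h0 L (by simp)]
    have h2 := interpolant_sub hh hK L x
    rw [h1, sub_zero] at h2
    rw [h2, intervalIntegral.integral_of_le hxL, setIntegral_eq_zero_of_forall_eq_zero]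
    intro t ht
    have h3 : (N : ℝ) + 1 ≤ ⌊t / h⌋ := by
      have : ((N + 1 : ℕ) : ℤ) ≤ ⌊t / h⌋ := by
        rw [Int.le_floor, le_div_iff₀ hh]
        push_cast
        rw [hN]
        exact ht.1.le
      exact_mod_cast this
    rw [interpolantSlope, h0 _ fun h' => by nlinarith [h'.2], h0 _ fun h' => by nlinarith [h'.2]]
    simp

theorem abs_interpolant_sub_le {N : ℕ} (hN : (N + 1) * h = L) (h0 : ∀ x, x ∉ Ioo 0 L → φ x = 0)
    (x : ℝ) : |interpolant h φ x - φ x| ≤ 2 * K * h := by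
  by_cases hx : x ∈ Ioo 0 L
  · have hfl := (Nat.floor_eq_iff (div_nonneg hx.1.le hh.le)).1 (rfl : ⌊x / h⌋₊ = ⌊x / h⌋₊)
    rw [le_div_iff₀ hh, div_lt_iff₀ hh] at hfl
    set i := ⌊x / h⌋₊
    have h1 := (lipschitzWith_interpolant hh hK).dist_le_mul x (i * h)
    have h2 := hK.dist_le_mul x (i * h)
    rw [Real.dist_eq, Real.dist_eq, abs_of_nonneg (sub_nonneg.2 hfl.1)] at h1 h2
    rw [interpolant_node hh hK (h0 0 (by simp))] at h1
    have h3 : (K : ℝ) * (x - i * h) ≤ K * h := by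
      gcongr
      linarith
    have h4 : interpolant h φ x - φ x = (interpolant h φ x - φ (i * h)) - (φ x - φ (i * h)) := by ring
    rw [h4]
    exact (abs_sub _ _).trans (by linarith)
  · rw [interpolant_eq_zero hh hK hN h0 hx, h0 x hx, sub_zero, abs_zero]
    positivity

end Interpolation

/-! ### The finite element spaces inside `ℍ(Ω)` -/

theorem meshSize_pos (hL : 0 < L) (N : ℕ) : 0 < meshSize L N := by
  unfold meshSize; positivity

theorem mul_meshSize (N : ℕ) : ((N : ℝ) + 1) * meshSize L N = L := by
  unfold meshSize; field_simp

theorem interpolant_mem_feSpaceCont (hL : 0 < L) {φ : ℝ → ℝ} {K : ℝ≥0} (hK : LipschitzWith K φ)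
    (h0 : ∀ x, x ∉ Ioo 0 L → φ x = 0) (N : ℕ) :
    interpolant (meshSize L N) φ ∈ feSpaceCont L N := by
  have hh := meshSize_pos hL N
  refine ⟨(lipschitzWith_interpolant hh hK).continuous,
    fun x hx => interpolant_eq_zero hh hK (mul_meshSize N) h0 hx, fun i _ => ?_⟩
  set h := meshSize L N
  set s := (φ (((i : ℤ) + 1 : ℝ) * h) - φ ((i : ℤ) * h)) / h with hs
  refine ⟨s, interpolant h φ ((i : ℤ) * h) - s * (i * h), fun x hx => ?_⟩
  rw [interpolant_cell hh hK (i := i) ⟨by exact_mod_cast hx.1.le, by exact_mod_cast hx.2.le⟩, ← hs]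
  push_cast
  ring

theorem feSpaceCont_subset (N : ℕ) : feSpaceCont L N ⊆ feSpace L N :=
  fun _ hv => ⟨hv.1.continuousOn, hv.2⟩

/-- An affine function restricted to the `i`-th cell. -/
noncomputable def cellAffine (L : ℝ) (N i : ℕ) (p q : ℝ) : ℝ → ℝ :=
  (Ioo (i * meshSize L N) ((i + 1) * meshSize L N)).indicator fun x => p * x + q

/-- If `x` and `x + t` both lie in the interval, the squared difference is `p² t² ≤ p² |t|`. If just
one does, the segment between them crosses `a` or `b`, and `B²` times a half-line indicator
difference pays for it; the half-open interval matches the half-lines `Ioi a` and `Ioi b`. -/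
theorem energy_indicator_affine_lt_top (a b p q : ℝ) :
    energy ((Ioc a b).indicator fun x => p * x + q) < ∞ := by
  obtain ⟨B, hB⟩ : ∃ B : ℝ, ∀ x ∈ Icc a b, |p * x + q| ≤ B :=
    isCompact_Icc.exists_bound_of_continuousOn (f := fun x : ℝ => p * x + q) (by fun_prop)
  set f := (Ioc a b).indicator fun x => p * x + q with hf
  have hfm : Measurable f := (by fun_prop : Measurable fun x : ℝ => p * x + q).indicator
    measurableSet_Ioc
  set H : ℝ → ℝ → ℝ := fun c => (Ioi c).indicator fun _ => 1 with hH
  set C := ENNReal.ofReal (p ^ 2) * ENNReal.ofReal (b - a)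
    + (ENNReal.ofReal (B ^ 2) + ENNReal.ofReal (B ^ 2)) with hC
  refine (energy_le_of_translation (C := C) hfm.aemeasurable fun t ht => ?_).trans_lt (by finiteness)
  have ht2 : t ^ 2 ≤ |t| := by
    rw [← sq_abs]
    have : |t| < 1 := abs_lt.2 ht
    nlinarith [abs_nonneg t]
  have hpt : ∀ x, ‖f x - f (x + t)‖ₑ ^ 2
      ≤ (Ioc a b).indicator (fun _ => ENNReal.ofReal (p ^ 2 * |t|)) x
        + (ENNReal.ofReal (B ^ 2) * ‖H a x - H a (x + t)‖ₑ ^ 2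
          + ENNReal.ofReal (B ^ 2) * ‖H b x - H b (x + t)‖ₑ ^ 2) := by
    intro x
    by_cases hx : x ∈ Ioc a b <;> by_cases hy : x + t ∈ Ioc a b
    · refine le_add_right ?_
      rw [indicator_of_mem hx, hf, indicator_of_mem hx, indicator_of_mem hy, enorm_sq_eq]
      apply ENNReal.ofReal_le_ofReal
      calc _ = p ^ 2 * t ^ 2 := by ring
        _ ≤ _ := by gcongr
    · refine le_add_left ?_
      have h1 : ‖f x - f (x + t)‖ₑ ^ 2 ≤ ENNReal.ofReal (B ^ 2) := by
        rw [hf, indicator_of_mem hx, indicator_of_notMem hy, sub_zero, enorm_sq_eq]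
        apply ENNReal.ofReal_le_ofReal
        have := abs_le.1 (hB x (Ioc_subset_Icc_self hx))
        exact sq_le_sq' this.1 this.2
      rcases le_or_gt (x + t) a with hya | hya
      · refine le_add_right (h1.trans ?_)
        rw [hH]
        simp [indicator, hx.1, not_lt.2 hya]
      · have hyb : b < x + t := by
          by_contra h'
          exact hy ⟨hya, not_lt.1 h'⟩
        refine le_add_left (h1.trans ?_)
        rw [hH]
        simp [indicator, hyb, not_lt.2 hx.2]
    · refine le_add_left ?_
      have h1 : ‖f x - f (x + t)‖ₑ ^ 2 ≤ ENNReal.ofReal (B ^ 2) := by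
        rw [hf, indicator_of_mem hy, indicator_of_notMem hx, zero_sub, enorm_neg, enorm_sq_eq]
        apply ENNReal.ofReal_le_ofReal
        have := abs_le.1 (hB _ (Ioc_subset_Icc_self hy))
        exact sq_le_sq' this.1 this.2
      rcases le_or_gt x a with hxa | hxa
      · refine le_add_right (h1.trans ?_)
        rw [hH]
        simp [indicator, hy.1, not_lt.2 hxa]
      · have hxb : b < x := by
          by_contra h'
          exact hx ⟨hxa, not_lt.1 h'⟩
        refine le_add_left (h1.trans ?_)
        rw [hH]
        simp [indicator, hxb, not_lt.2 hy.2]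
    · rw [hf, indicator_of_notMem hx, indicator_of_notMem hy]
      simp
  have hHm : ∀ c, Measurable fun x => ENNReal.ofReal (B ^ 2) * ‖H c x - H c (x + t)‖ₑ ^ 2 := by
    intro c
    have h1 : Measurable (H c) := measurable_indicator_Ioi c
    exact (((h1.sub (h1.comp (measurable_id.add_const t))).enorm).pow_const 2).const_mul _
  calc _ ≤ _ := lintegral_mono hpt
    _ ≤ ENNReal.ofReal (p ^ 2 * |t|) * ENNReal.ofReal (b - a)
        + (ENNReal.ofReal (B ^ 2) * ENNReal.ofReal |t|
          + ENNReal.ofReal (B ^ 2) * ENNReal.ofReal |t|) := by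
        rw [lintegral_add_left (measurable_const.indicator measurableSet_Ioc),
          lintegral_add_left (hHm a), lintegral_indicator_const measurableSet_Ioc, Real.volume_Ioc,
          lintegral_const_mul' _ _ ENNReal.ofReal_ne_top,
          lintegral_const_mul' _ _ ENNReal.ofReal_ne_top]
        gcongr
        · exact lintegral_indicator_Ioi_translation a t
        · exact lintegral_indicator_Ioi_translation b t
    _ = _ := by
        rw [ENNReal.ofReal_mul (by positivity), hC]
        ring

theorem memH_cellAffine (hL : 0 < L) {N i : ℕ} (hi : i ≤ N) (p q : ℝ) :
    MemH L (cellAffine L N i p q) := by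
  set h := meshSize L N with hh
  have hpos : 0 < h := meshSize_pos hL N
  have hsub : Ioo ((i : ℝ) * h) ((i + 1) * h) ⊆ Ioo 0 L := by
    refine Ioo_subset_Ioo (by positivity) ?_
    have h1 : (i : ℝ) ≤ N := by exact_mod_cast hi
    rw [← mul_meshSize (L := L) N, ← hh]
    gcongr
  have h0 : ∀ x, x ∉ Ioo 0 L → cellAffine L N i p q x = 0 := fun x hx =>
    indicator_of_notMem (fun h' => hx (hsub h')) _
  obtain ⟨B, hB⟩ : ∃ B : ℝ, ∀ x ∈ Icc ((i : ℝ) * h) ((i + 1) * h), |p * x + q| ≤ B :=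
    isCompact_Icc.exists_bound_of_continuousOn (f := fun x : ℝ => p * x + q) (by fun_prop)
  have hm : Measurable (cellAffine L N i p q) :=
    (by fun_prop : Measurable fun x : ℝ => p * x + q).indicator measurableSet_Ioo
  refine memH_iff.2 ⟨memLp_of_bounded hm.aemeasurable (M := |B|) (fun x => ?_) h0, h0, ?_⟩
  · unfold cellAffine indicator
    split_ifs with hx
    · exact (hB x (Ioo_subset_Icc_self hx)).trans (le_abs_self _)
    · simp
  · rw [cellAffine, energy_congr (indicator_ae_eq_of_ae_eq_set Ioo_ae_eq_Ioc)]
    exact energy_indicator_affine_lt_top _ _ _ _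

/-- Equality holds only off the nodes, a countable set on which the sum vanishes. -/
theorem ae_eq_sum_cellAffine (hL : 0 < L) {N : ℕ} {v : ℝ → ℝ} (hv : v ∈ feSpace L N) :
    ∃ p q : ℕ → ℝ, v =ᵐ[volume] ∑ i ∈ Finset.range (N + 1), cellAffine L N i (p i) (q i) := by
  set h := meshSize L N with hh
  have hpos : 0 < h := meshSize_pos hL N
  have hpq : ∀ i : ℕ, ∃ p q : ℝ, i ≤ N →
      ∀ x ∈ Ioo (i * h) ((i + 1) * h), v x = p * x + q := by
    intro i
    by_cases hi : i ≤ N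
    · obtain ⟨p, q, hpq⟩ := hv.2.2 i hi
      exact ⟨p, q, fun _ => hpq⟩
    · exact ⟨0, 0, fun h' => absurd h' hi⟩
  choose p q hpq using hpq
  refine ⟨p, q, ?_⟩
  refine ae_eq_of_restrict (L := L) hv.2.1 (fun x hx => ?_) ?_
  · rw [Finset.sum_apply]
    exact Finset.sum_eq_zero fun i hi =>
      (memH_cellAffine hL (Nat.lt_succ_iff.1 (Finset.mem_range.1 hi)) _ _).eq_zero x hx
  · have hnodes : ∀ᵐ x : ℝ, x ∉ range fun i : ℕ => (i : ℝ) * h :=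
      (countable_range _).ae_notMem volume
    filter_upwards [ae_restrict_of_ae hnodes, ae_restrict_mem measurableSet_Ioo] with x hxn hx
    have hmem : ∀ i : ℕ, x ∈ Ioo ((i : ℝ) * h) ((i + 1) * h) ↔ ⌊x / h⌋₊ = i := by
      intro i
      rw [Nat.floor_eq_iff (div_nonneg hx.1.le hpos.le), le_div_iff₀ hpos, div_lt_iff₀ hpos, mem_Ioo]
      refine and_congr_left fun _ => ⟨le_of_lt, fun h' => lt_of_le_of_ne h' fun h'' => hxn ⟨i, h''⟩⟩
    have hlt : ⌊x / h⌋₊ < N + 1 := by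
      rw [Nat.floor_lt (div_nonneg hx.1.le hpos.le), div_lt_iff₀ hpos]
      push_cast
      rw [mul_meshSize]
      exact hx.2
    rw [Finset.sum_apply, Finset.sum_eq_single ⌊x / h⌋₊]
    · rw [cellAffine, ← hh, indicator_of_mem ((hmem _).2 rfl)]
      exact hpq _ (Nat.lt_succ_iff.1 hlt) x ((hmem _).2 rfl)
    · intro i _ hi
      exact indicator_of_notMem (fun h' => hi ((hmem i).1 h').symm) _
    · intro hnot
      exact absurd (Finset.mem_range.2 hlt) hnot

theorem memH_of_mem_feSpace (hL : 0 < L) {N : ℕ} {v : ℝ → ℝ} (hv : v ∈ feSpace L N) : MemH L v := by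
  obtain ⟨p, q, hpq⟩ := ae_eq_sum_cellAffine hL hv
  refine MemH.congr (Submodule.sum_mem (functionSpace L) fun i hi => ?_) hpq.symm hv.2.1
  exact memH_cellAffine hL (Nat.lt_succ_iff.1 (Finset.mem_range.1 hi)) _ _

theorem IsPiecewiseAffine.add {N : ℕ} {u v : ℝ → ℝ} (hu : IsPiecewiseAffine L N u)
    (hv : IsPiecewiseAffine L N v) : IsPiecewiseAffine L N (u + v) := fun i hi => by
  obtain ⟨a, b, h⟩ := hu i hi
  obtain ⟨a', b', h'⟩ := hv i hi
  exact ⟨a + a', b + b', fun x hx => by rw [Pi.add_apply, h x hx, h' x hx]; ring⟩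

theorem IsPiecewiseAffine.smul {N : ℕ} {u : ℝ → ℝ} (c : ℝ) (hu : IsPiecewiseAffine L N u) :
    IsPiecewiseAffine L N (c • u) := fun i hi => by
  obtain ⟨a, b, h⟩ := hu i hi
  exact ⟨c * a, c * b, fun x hx => by rw [Pi.smul_apply, smul_eq_mul, h x hx]; ring⟩

theorem isPiecewiseAffine_zero (N : ℕ) : IsPiecewiseAffine L N 0 :=
  fun _ _ => ⟨0, 0, fun x _ => by simp⟩

/-- `feSpace` as a submodule. -/
def feSubmodule (L : ℝ) (N : ℕ) : Submodule ℝ (ℝ → ℝ) where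
  carrier := feSpace L N
  add_mem' hu hv := ⟨hu.1.add hv.1, fun x hx => by simp [hu.2.1 x hx, hv.2.1 x hx],
    hu.2.2.add hv.2.2⟩
  zero_mem' := ⟨continuousOn_const, fun _ _ => rfl, isPiecewiseAffine_zero N⟩
  smul_mem' c _ hu := ⟨hu.1.const_smul c, fun x hx => by simp [hu.2.1 x hx], hu.2.2.smul c⟩

/-- `feSpaceCont` as a submodule. -/
def feSubmoduleCont (L : ℝ) (N : ℕ) : Submodule ℝ (ℝ → ℝ) where
  carrier := feSpaceCont L N
  add_mem' hu hv := ⟨hu.1.add hv.1, fun x hx => by simp [hu.2.1 x hx, hv.2.1 x hx],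
    hu.2.2.add hv.2.2⟩
  zero_mem' := ⟨continuous_const, fun _ _ => rfl, isPiecewiseAffine_zero N⟩
  smul_mem' c _ hu := ⟨hu.1.const_smul c, fun x hx => by simp [hu.2.1 x hx], hu.2.2.smul c⟩

theorem feSubmoduleCont_le (N : ℕ) : feSubmoduleCont L N ≤ feSubmodule L N := feSpaceCont_subset N

/-- The classes in `ℍ(Ω)` of a space of functions. -/
noncomputable def classes (L : ℝ) (F : Submodule ℝ (ℝ → ℝ)) : Submodule ℝ (hilbertSpace L) :=
  (F.comap (functionSpace L).subtype).map (toHilbert L)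

theorem mem_classes {F : Submodule ℝ (ℝ → ℝ)} (u : functionSpace L) (hu : u.1 ∈ F) :
    toHilbert L u ∈ classes L F := ⟨u, hu, rfl⟩

theorem classes_mono {F G : Submodule ℝ (ℝ → ℝ)} (h : F ≤ G) : classes L F ≤ classes L G :=
  Submodule.map_mono (Submodule.comap_mono h)

theorem finiteDimensional_classes (hL : 0 < L) {N : ℕ} {F : Submodule ℝ (ℝ → ℝ)}
    (hF : F ≤ feSubmodule L N) : FiniteDimensional ℝ (classes L F) := by
  -- On each cell the flag selects the function `x` or the constant `1`. These need not belong to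
  -- `F`; only their span has to contain its classes.
  set e : Fin (N + 1) × Bool → hilbertSpace L := fun j => toHilbert L
    ⟨cellAffine L N j.1 (if j.2 then 1 else 0) (if j.2 then 0 else 1),
      memH_cellAffine hL (Nat.lt_succ_iff.1 j.1.2) _ _⟩ with he
  have hfin : FiniteDimensional ℝ (Submodule.span ℝ (range e)) :=
    FiniteDimensional.span_of_finite ℝ (finite_range e)
  refine Submodule.finiteDimensional_of_le (S₂ := Submodule.span ℝ (range e)) ?_
  rintro _ ⟨u, hu, rfl⟩
  obtain ⟨p, q, hpq⟩ := ae_eq_sum_cellAffine hL (hF hu)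
  have hsum : toHilbert L u = ∑ i : Fin (N + 1), (p i • e (i, true) + q i • e (i, false)) := by
    simp only [he, ← map_smul, ← map_add, ← map_sum]
    rw [toHilbert_eq_iff]
    refine hpq.trans (Eventually.of_forall fun x => ?_)
    rw [← Fin.sum_univ_eq_sum_range (fun i => cellAffine L N i (p i) (q i)) (N + 1)]
    simp only [Submodule.coe_sum, Finset.sum_apply, Submodule.coe_add, Submodule.coe_smul,
      Pi.add_apply, Pi.smul_apply, smul_eq_mul]
    refine Finset.sum_congr rfl fun i _ => ?_
    simp only [cellAffine, indicator, if_true, Bool.false_eq_true, if_false]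
    split_ifs <;> ring
  rw [hsum]
  refine Submodule.sum_mem _ fun i _ => Submodule.add_mem _ ?_ ?_
  · exact Submodule.smul_mem _ _ (Submodule.subset_span ⟨_, rfl⟩)
  · exact Submodule.smul_mem _ _ (Submodule.subset_span ⟨_, rfl⟩)

/-- Continuity inside `Ω` turns equality of classes into equality of functions. This yields literal
uniqueness of the discrete solution and positive norm for nonzero test functions. -/
theorem eq_of_ae_eq_of_mem_feSpace {N : ℕ} {u v : ℝ → ℝ} (hu : u ∈ feSpace L N)
    (hv : v ∈ feSpace L N) (h : u =ᵐ[volume] v) : u = v := by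
  have h1 : EqOn u v (Ioo 0 L) :=
    Measure.eqOn_open_of_ae_eq (ae_restrict_of_ae h) isOpen_Ioo hu.1 hv.1
  ext x
  by_cases hx : x ∈ Ioo 0 L
  · exact h1 hx
  · rw [hu.2.1 x hx, hv.2.1 x hx]

/-! ### Approximability by the finite element spaces -/

section Limit

variable {H : Type*} [NormedAddCommGroup H] [InnerProductSpace ℝ H]

/-- The vectors approximated by a sequence of subspaces. -/
def approximable (W : ℕ → Submodule ℝ H) : Submodule ℝ H where
  carrier := {x | ∀ ε > 0, ∃ N₀, ∀ N ≥ N₀, ∃ w ∈ W N, ‖x - w‖ ≤ ε}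
  add_mem' {x y} hx hy ε hε := by
    obtain ⟨n, hn⟩ := hx (ε / 2) (half_pos hε)
    obtain ⟨m, hm⟩ := hy (ε / 2) (half_pos hε)
    refine ⟨max n m, fun N hN => ?_⟩
    obtain ⟨w, hw, hxw⟩ := hn N (le_of_max_le_left hN)
    obtain ⟨w', hw', hyw⟩ := hm N (le_of_max_le_right hN)
    refine ⟨w + w', Submodule.add_mem _ hw hw', ?_⟩
    rw [add_sub_add_comm]
    exact (norm_add_le _ _).trans (by linarith)
  zero_mem' ε hε := ⟨0, fun N _ => ⟨0, Submodule.zero_mem _, by simpa using hε.le⟩⟩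
  smul_mem' c x hx ε hε := by
    obtain ⟨n, hn⟩ := hx (ε / (‖c‖ + 1)) (by positivity)
    refine ⟨n, fun N hN => ?_⟩
    obtain ⟨w, hw, hxw⟩ := hn N hN
    refine ⟨c • w, Submodule.smul_mem _ _ hw, ?_⟩
    rw [← smul_sub, norm_smul]
    calc ‖c‖ * ‖x - w‖ ≤ (‖c‖ + 1) * (ε / (‖c‖ + 1)) := by
          gcongr; linarith
      _ = ε := by field_simp

theorem isClosed_approximable (W : ℕ → Submodule ℝ H) : IsClosed (approximable W : Set H) := by
  refine isClosed_of_closure_subset fun x hx ε hε => ?_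
  obtain ⟨y, hy, hxy⟩ := Metric.mem_closure_iff.1 hx (ε / 2) (half_pos hε)
  obtain ⟨n, hn⟩ := hy (ε / 2) (half_pos hε)
  refine ⟨n, fun N hN => ?_⟩
  obtain ⟨w, hw, hyw⟩ := hn N hN
  refine ⟨w, hw, ?_⟩
  rw [dist_eq_norm] at hxy
  rw [← sub_add_sub_cancel x y w]
  exact (norm_add_le _ _).trans (by linarith)

end Limit

theorem tendsto_meshSize (L : ℝ) : Tendsto (meshSize L) atTop (𝓝 0) := by
  have := (tendsto_one_div_add_atTop_nhds_zero_nat (𝕜 := ℝ)).const_mul L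
  rw [mul_zero] at this
  exact this.congr fun N => by rw [meshSize]; ring

/-- The interpolation error is at most `2 K h` in sup norm and has Lipschitz constant `2 K`, so its
energy is of order `h`. -/
theorem mem_approximable_of_lipschitz (hL : 0 < L) (u : functionSpace L)
    (hu : ∃ K : ℝ≥0, LipschitzWith K u.1) :
    toHilbert L u ∈ approximable fun N => classes L (feSubmoduleCont L N) := by
  obtain ⟨K, hK⟩ := hu
  obtain ⟨P, hP, hPu⟩ := exists_poincare L
  intro ε hε
  have hlim : Tendsto (fun N => P * (2 * (4 * (2 * K * meshSize L N) * (K + K : ℝ≥0) * L))) atTop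
      (𝓝 (P * (2 * (4 * (2 * K * 0) * (K + K : ℝ≥0) * L)))) :=
    (((((tendsto_meshSize L).const_mul _).const_mul _).mul_const _).mul_const _
      |>.const_mul _).const_mul _
  simp only [mul_zero, zero_mul] at hlim
  obtain ⟨N₀, hN₀⟩ := eventually_atTop.1
    (hlim.eventually_lt_const (show (0 : ℝ) < ε ^ 2 by positivity))
  refine ⟨N₀, fun N hN => ?_⟩
  have hh := meshSize_pos hL N
  have hI := interpolant_mem_feSpaceCont hL hK u.2.eq_zero N
  set w : functionSpace L := ⟨_, memH_of_mem_feSpace hL (feSpaceCont_subset N hI)⟩ with hw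
  refine ⟨toHilbert L w, mem_classes w hI, ?_⟩
  have henergy : energy (w - u).1
      ≤ 2 * ENNReal.ofReal (4 * (2 * K * meshSize L N) * (K + K : ℝ≥0) * L) :=
    energy_le_of_lipschitz hL ((lipschitzWith_interpolant hh hK).sub hK)
      (abs_interpolant_sub_le hh hK (mul_meshSize N) u.2.eq_zero) (w - u).2.eq_zero
  have h1 := ENNReal.toReal_mono (by finiteness) henergy
  rw [ENNReal.toReal_mul, ENNReal.toReal_ofReal (by positivity), ENNReal.toReal_ofNat] at h1
  rw [norm_sub_rev, ← map_sub]
  refine le_of_sq_le_sq ?_ hε.le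
  exact ((hPu _).trans (mul_le_mul_of_nonneg_left h1 hP)).trans (hN₀ N hN).le

/-- Keeps the set of quotients in the inf-sup condition nonempty. For `N = 0` the continuous space
is trivial, hence `1 ≤ N`; the witness interpolates a tent function, positive at the first interior
node. -/
theorem exists_ne_zero_mem_feSpaceCont (hL : 0 < L) {N : ℕ} (hN : 1 ≤ N) :
    ∃ v ∈ feSpaceCont L N, v ≠ 0 := by
  set φ : ℝ → ℝ := fun x => max 0 (min x (L - x)) with hφ
  have hK : LipschitzWith 1 φ := by
    refine LipschitzWith.of_dist_le_mul fun x y => ?_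
    rw [Real.dist_eq, Real.dist_eq, NNReal.coe_one, one_mul]
    refine (abs_max_sub_max_le_max _ _ _ _).trans ?_
    rw [sub_self, abs_zero, max_eq_right (abs_nonneg _)]
    refine (abs_min_sub_min_le_max _ _ _ _).trans ?_
    rw [sub_sub_sub_cancel_left, abs_sub_comm y x, max_self]
  have h0 : ∀ x, x ∉ Ioo 0 L → φ x = 0 := by
    intro x hx
    refine max_eq_left ?_
    by_contra h
    rw [not_le, lt_min_iff] at h
    exact hx ⟨h.1, by linarith [h.2]⟩
  have hh := meshSize_pos hL N
  refine ⟨_, interpolant_mem_feSpaceCont hL hK h0 N, fun hzero => ?_⟩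
  have h1 := interpolant_node hh hK (h0 0 (by simp)) 1
  rw [hzero, Nat.cast_one, one_mul, Pi.zero_apply] at h1
  have h2 : 0 < L - meshSize L N := by
    have h3 := mul_meshSize (L := L) N
    have h4 : (1 : ℝ) ≤ N := by exact_mod_cast hN
    nlinarith
  have h5 : 0 < φ (meshSize L N) := lt_max_of_lt_right (lt_min hh h2)
  linarith

/-! ### Equivalence of norms, inf-sup condition and quasi-optimality -/

theorem normH_eq (u : functionSpace L) : normH u.1 = √((energy u.1).toReal) := by
  rw [normH, formE_self u.2]

theorem normH_le (u : functionSpace L) : normH u.1 ≤ ‖toHilbert L u‖ := by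
  rw [normH_eq]
  refine Real.sqrt_le_left (norm_nonneg _) |>.2 ?_
  rw [norm_toHilbert_sq]
  exact le_add_of_nonneg_left (by positivity)

theorem exists_norm_le (L : ℝ) : ∃ c > (0 : ℝ), ∀ u : functionSpace L,
    ‖toHilbert L u‖ ≤ c * normH u.1 := by
  obtain ⟨P, hP, hPu⟩ := exists_poincare L
  refine ⟨√P + 1, by positivity, fun u => ?_⟩
  have h1 := Real.le_sqrt_of_sq_le (hPu u)
  rw [Real.sqrt_mul hP, ← normH_eq] at h1
  have h2 : 0 ≤ normH u.1 := Real.sqrt_nonneg _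
  linarith

theorem inner_starProjection_of_mem {H : Type*} [NormedAddCommGroup H] [InnerProductSpace ℝ H]
    (V : Submodule ℝ H) [V.HasOrthogonalProjection] (x : H) {v : H} (hv : v ∈ V) :
    ⟪V.starProjection x, v⟫_ℝ = ⟪x, v⟫_ℝ := by
  rw [V.inner_starProjection_left_eq_right, Submodule.starProjection_eq_self_iff.2 hv]

section Galerkin

variable {N : ℕ} {F : Submodule ℝ (ℝ → ℝ)} [(classes L F).HasOrthogonalProjection] {α c : ℝ}

/-- Testing with the projection `v` of `u + K u` gives `ℰ_L(u,v) = ‖v‖²`. Since `normH v ≤ ‖v‖` and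
`normH u ≤ ‖u‖`, the passage from the graph norm to `normH` keeps the same `α`. -/
theorem discreteInfSup_of_lower_bound (hL : 0 < L) (hF : F ≤ feSubmodule L N)
    (hF0 : ∃ v ∈ F, v ≠ 0) (hα : 0 < α) (hlow : ∀ u ∈ classes L F,
      α * ‖u‖ ≤ ‖(classes L F).starProjection (u + perturbation L u)‖)
    (hc : ∀ u : functionSpace L, ‖toHilbert L u‖ ≤ c * normH u.1) :
    DiscreteInfSup (F : Set (ℝ → ℝ)) α := by
  have hmem : ∀ v ∈ F, MemH L v := fun v hv => memH_of_mem_feSpace hL (hF hv)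
  have hpos : ∀ v : functionSpace L, v.1 ∈ F → v.1 ≠ 0 → 0 < normH v.1 := by
    intro v hv hv0
    refine lt_of_le_of_ne (Real.sqrt_nonneg _) fun h => hv0 ?_
    have h1 := hc v
    rw [← h, mul_zero, norm_le_zero_iff, ← map_zero (toHilbert L), toHilbert_eq_iff] at h1
    exact eq_of_ae_eq_of_mem_feSpace (hF hv) (feSubmodule L N).zero_mem h1
  intro u' hu'
  set u : functionSpace L := ⟨u', hmem u' hu'⟩ with hu
  set T := toHilbert L u + perturbation L (toHilbert L u) with hT
  set S := {q : ℝ | ∃ v ∈ (F : Set (ℝ → ℝ)), v ≠ 0 ∧ q = formEL u' v / normH v} with hS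
  have hbdd : BddAbove S := by
    refine ⟨‖T‖ * c, ?_⟩
    rintro q ⟨v, hv, hv0, rfl⟩
    rw [div_le_iff₀ (hpos ⟨v, hmem v hv⟩ hv hv0), formEL_eq u ⟨v, hmem v hv⟩, mul_assoc]
    exact (real_inner_le_norm _ _).trans (by gcongr; exact hc _)
  have hne : S.Nonempty := by
    obtain ⟨v, hv, hv0⟩ := hF0
    exact ⟨_, v, hv, hv0, rfl⟩
  refine ⟨sSup S, isLUB_csSup hne hbdd, ?_⟩
  have hlowu := hlow _ (mem_classes u hu')
  rw [← hT] at hlowu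
  have hnu : α * normH u' ≤ α * ‖toHilbert L u‖ := by gcongr; exact normH_le u
  obtain ⟨v, hv, hvT⟩ := ((classes L F).starProjection_apply_mem T)
  -- A zero test function is not admissible, but then the lower bound forces the class of `u` to
  -- vanish and any nonzero `w` gives the quotient `0`.
  by_cases hv0 : v.1 = 0
  · have hv0' : v = 0 := Subtype.ext hv0
    rw [← hvT, hv0', map_zero, norm_zero] at hlowu
    have hu0 : toHilbert L u = 0 := norm_le_zero_iff.1 (nonpos_of_mul_nonpos_right hlowu hα)
    rw [hu0, norm_zero, mul_zero] at hnu
    obtain ⟨w, hw, hw0⟩ := hF0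
    refine hnu.trans (le_csSup hbdd ⟨w, hw, hw0, ?_⟩)
    rw [formEL_eq u ⟨w, hmem w hw⟩, hu0, map_zero, add_zero, inner_zero_left, zero_div]
  · have hvpos := hpos v hv hv0
    have hq : ‖toHilbert L v‖ ≤ formEL u' v.1 / normH v.1 := by
      rw [le_div_iff₀ hvpos, formEL_eq u v, ← hT, ← inner_starProjection_of_mem (classes L F) T
        (mem_classes v hv), ← hvT, real_inner_self_eq_norm_sq, pow_two]
      gcongr
      exact normH_le v
    rw [← hvT] at hlowu
    exact (hnu.trans (hlowu.trans hq)).trans (le_csSup hbdd ⟨v.1, hv, hv0, rfl⟩)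

/-- Céa's argument: Galerkin orthogonality replaces `uh` by `U` under the projection, so stability
applied to `uh - w` bounds it by `U - w`. -/
theorem normH_sub_le_of_lower_bound (hα : 0 < α)
    (hlow : ∀ u ∈ classes L F,
      α * ‖u‖ ≤ ‖(classes L F).starProjection (u + perturbation L u)‖)
    (hc : ∀ u : functionSpace L, ‖toHilbert L u‖ ≤ c * normH u.1) {U uh : functionSpace L}
    (huh : uh.1 ∈ F)
    (hU : (classes L F).starProjection (toHilbert L U + perturbation L (toHilbert L U))
      = (classes L F).starProjection (toHilbert L uh + perturbation L (toHilbert L uh)))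
    (w : functionSpace L) (hw : w.1 ∈ F) :
    normH (U.1 - uh.1) ≤ (1 + (1 + ‖perturbation L‖) / α) * c * normH (U.1 - w.1) := by
  set V := classes L F with hV
  set K := perturbation L with hK
  set C := 1 + (1 + ‖K‖) / α with hC
  have hC0 : 0 ≤ C := by positivity
  have h1 := hlow _ (V.sub_mem (mem_classes uh huh) (mem_classes w hw))
  have h2 : V.starProjection (toHilbert L uh - toHilbert L w
      + K (toHilbert L uh - toHilbert L w))
      = V.starProjection (toHilbert L (U - w) + K (toHilbert L (U - w))) := by
    have e1 : toHilbert L uh - toHilbert L w + K (toHilbert L uh - toHilbert L w)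
        = (toHilbert L uh + K (toHilbert L uh)) - (toHilbert L w + K (toHilbert L w)) := by
      rw [map_sub]; abel
    have e2 : toHilbert L (U - w) + K (toHilbert L (U - w))
        = (toHilbert L U + K (toHilbert L U)) - (toHilbert L w + K (toHilbert L w)) := by
      rw [map_sub, map_sub]; abel
    rw [e1, e2, map_sub, map_sub, hU]
  rw [h2] at h1
  have h3 : α * ‖toHilbert L uh - toHilbert L w‖ ≤ (1 + ‖K‖) * ‖toHilbert L (U - w)‖ := by
    refine h1.trans ((V.norm_starProjection_apply_le _).trans ((norm_add_le _ _).trans ?_))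
    rw [add_mul, one_mul]
    gcongr
    exact K.le_opNorm _
  have h4 : ‖toHilbert L uh - toHilbert L w‖
      ≤ (1 + ‖K‖) / α * ‖toHilbert L (U - w)‖ := by
    rw [div_mul_eq_mul_div, le_div_iff₀ hα, mul_comm]
    exact h3
  calc normH (U.1 - uh.1) ≤ ‖toHilbert L (U - uh)‖ := normH_le (U - uh)
    _ = ‖toHilbert L (U - w) - (toHilbert L uh - toHilbert L w)‖ := by
        rw [map_sub, map_sub]; congr 1; abel
    _ ≤ ‖toHilbert L (U - w)‖ + (1 + ‖K‖) / α * ‖toHilbert L (U - w)‖ :=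
        (norm_sub_le _ _).trans (by gcongr)
    _ = C * ‖toHilbert L (U - w)‖ := by rw [hC]; ring
    _ ≤ C * (c * normH (U.1 - w.1)) := by gcongr; exact hc (U - w)
    _ = _ := by ring

-- The lower bound makes the projected operator `A` injective on a finite-dimensional space, hence
-- bijective; its equation with the projected Riesz representative `g` of `f` is the discrete
-- problem.
set_option maxHeartbeats 800000 in
theorem quasiOptimal_of_lower_bound (hL : 0 < L) (hF : F ≤ feSubmodule L N) (hα : 0 < α) (hc0 : 0 ≤ c)
    (hlow : ∀ u ∈ classes L F,
      α * ‖u‖ ≤ ‖(classes L F).starProjection (u + perturbation L u)‖)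
    (hc : ∀ u : functionSpace L, ‖toHilbert L u‖ ≤ c * normH u.1) :
    QuasiOptimal L (F : Set (ℝ → ℝ)) ((1 + (1 + ‖perturbation L‖) / α) * c) := by
  have hmem : ∀ v ∈ F, MemH L v := fun v hv => memH_of_mem_feSpace hL (hF hv)
  have hfd : FiniteDimensional ℝ (classes L F) := finiteDimensional_classes hL hF
  set V := classes L F with hV
  set K := perturbation L with hK
  set A : V →ₗ[ℝ] V := (V.orthogonalProjectionOnto ∘L (ContinuousLinearMap.id ℝ _ + K) ∘L
    V.subtypeL).toLinearMap with hA
  have hAcoe : ∀ x : V, (A x : hilbertSpace L) = V.starProjection (x + K x) := fun x => rfl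
  have hAinj : Function.Injective A := by
    rw [injective_iff_map_eq_zero]
    intro x hx
    have h1 := hlow x x.2
    rw [← hAcoe, hx] at h1
    simp only [Submodule.coe_zero, norm_zero] at h1
    exact Subtype.ext (norm_le_zero_iff.1 (nonpos_of_mul_nonpos_right h1 hα))
  have hAsurj := LinearMap.injective_iff_surjective.1 hAinj
  intro f hf
  set g : hilbertSpace L := ContinuousLinearMap.adjoint (embedding L) (hf.toLp f) with hg
  have hgv : ∀ v : functionSpace L, ∫ x in Ioo 0 L, f x * v.1 x = ⟪g, toHilbert L v⟫_ℝ := by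
    intro v
    rw [hg, ContinuousLinearMap.adjoint_inner_left, embedding_toHilbert, inner_toLp]
  have hsol : ∀ w : functionSpace L, w.1 ∈ F →
      (IsDiscreteSolution L (F : Set (ℝ → ℝ)) f w.1 ↔
        V.starProjection (toHilbert L w + K (toHilbert L w)) = V.starProjection g) := by
    intro w hw
    constructor
    · rintro ⟨-, h⟩
      rw [← sub_eq_zero, ← map_sub, Submodule.starProjection_apply_eq_zero_iff,
        Submodule.mem_orthogonal']
      rintro _ ⟨v, hv, rfl⟩
      rw [inner_sub_left, ← hgv, ← formEL_eq, h v.1 hv, sub_self]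
    · intro h
      refine ⟨hw, fun v hv => ?_⟩
      have h1 := mem_classes (L := L) ⟨v, hmem v hv⟩ hv
      rw [formEL_eq w ⟨v, hmem v hv⟩, hgv ⟨v, hmem v hv⟩,
        ← inner_starProjection_of_mem V _ h1, h, inner_starProjection_of_mem V _ h1]
  obtain ⟨⟨x, uh, huhF, hx⟩, hAx⟩ := hAsurj (V.orthogonalProjectionOnto g)
  have huh : V.starProjection (toHilbert L uh + K (toHilbert L uh)) = V.starProjection g := by
    have := congrArg (Subtype.val) hAx
    rw [hAcoe] at this
    simp only [← hx] at this
    exact this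
  refine ⟨uh.1, (hsol uh huhF).2 huh, fun wh hwh => ?_, fun u hu => ?_⟩
  · have hw := (hsol ⟨wh, hmem wh hwh.1⟩ hwh.1).1 hwh
    have h1 : A ⟨_, mem_classes ⟨wh, hmem wh hwh.1⟩ hwh.1⟩ = A ⟨_, mem_classes uh huhF⟩ := by
      refine Subtype.ext ?_
      rw [hAcoe, hAcoe]
      exact hw.trans huh.symm
    have h2 := (toHilbert_eq_iff _ _).1 (congrArg Subtype.val (hAinj h1))
    exact eq_of_ae_eq_of_mem_feSpace (hF hwh.1) (hF huhF) h2
  · have hC0 : 0 ≤ (1 + (1 + ‖K‖) / α) * c := by positivity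
    set U : functionSpace L := ⟨u, hu.1⟩ with hU
    have hUg : V.starProjection (toHilbert L U + K (toHilbert L U)) = V.starProjection g := by
      rw [← sub_eq_zero, ← map_sub, Submodule.starProjection_apply_eq_zero_iff,
        Submodule.mem_orthogonal']
      rintro _ ⟨v, hv, rfl⟩
      rw [inner_sub_left, ← hgv, ← formEL_eq, hu.2 v.1 v.2, sub_self]
    have hbest : ∀ w ∈ F, normH (u - uh.1) ≤ (1 + (1 + ‖K‖) / α) * c * normH (u - w) := fun w hw =>
      normH_sub_le_of_lower_bound hα hlow hc huhF (hUg.trans huh.symm) ⟨w, hmem w hw⟩ hw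
    rw [Real.mul_iInf_of_nonneg hC0]
    have : Nonempty (F : Set (ℝ → ℝ)) := ⟨⟨0, F.zero_mem⟩⟩
    exact le_ciInf fun w => hbest w.1 w.2

end Galerkin

end LogLaplacian

open LogLaplacian in
theorem lemma4p2 (L : ℝ) (hL : 0 < L)
    (htriv : ∀ u : ℝ → ℝ, LogLaplacian.IsWeakSolution L 0 u → u =ᵐ[volume] 0) :
    ∃ h₀ : ℝ, 0 < h₀ ∧ ∃ α₀ : ℝ, 0 < α₀ ∧ ∃ C : ℝ, 0 < C ∧
      ∀ N : ℕ, LogLaplacian.meshSize L N < h₀ →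
        ∀ V : Set (ℝ → ℝ),
          (V = LogLaplacian.feSpace L N ∨ V = LogLaplacian.feSpaceCont L N) →
          LogLaplacian.DiscreteInfSup V α₀ ∧ LogLaplacian.QuasiOptimal L V C := by
  have hdense : ∀ z : hilbertSpace L, z ∈ approximable fun N => classes L (feSubmoduleCont L N) :=
    mem_of_lipschitz_mem (isClosed_approximable _) (mem_approximable_of_lipschitz hL)
  obtain ⟨N₀, α, hα, hlow⟩ := exists_uniform_lower_bound
    (isCompactOperator_perturbation (isCompactOperator_embedding L))
    (perturbation_injective htriv) _ hdense
  obtain ⟨c, hc, hcu⟩ := exists_norm_le L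
  -- With this `h₀`, a mesh size below it means `N₀ < N`; strictness also supplies `1 ≤ N`.
  refine ⟨meshSize L N₀, meshSize_pos hL N₀, α, hα,
    (1 + (1 + ‖perturbation L‖) / α) * c, by positivity, fun N hN V hV => ?_⟩
  have hlt : N₀ < N := by
    rw [meshSize, meshSize, div_lt_div_iff_of_pos_left hL (by positivity) (by positivity)] at hN
    exact_mod_cast (add_lt_add_iff_right 1).1 hN
  obtain ⟨v₀, hv₀, hv₀'⟩ := exists_ne_zero_mem_feSpaceCont hL (Nat.one_le_of_lt hlt)
  -- Any space between the two finite element spaces is admissible, so both choices are end points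
  -- of one statement.
  have key : ∀ F : Submodule ℝ (ℝ → ℝ), feSubmoduleCont L N ≤ F → F ≤ feSubmodule L N →
      DiscreteInfSup (F : Set (ℝ → ℝ)) α ∧
        QuasiOptimal L (F : Set (ℝ → ℝ)) ((1 + (1 + ‖perturbation L‖) / α) * c) := by
    intro F hF hF'
    have hfd : FiniteDimensional ℝ (classes L F) := finiteDimensional_classes hL hF'
    have hl := hlow N hlt.le (classes L F) (classes_mono hF)
    exact ⟨discreteInfSup_of_lower_bound hL hF' ⟨v₀, hF hv₀, hv₀'⟩ hα hl hcu,
      quasiOptimal_of_lower_bound hL hF' hα hc.le hl hcu⟩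
  rcases hV with rfl | rfl
  · exact key (feSubmodule L N) (feSubmoduleCont_le N) le_rfl
  · exact key (feSubmoduleCont L N) le_rfl (feSubmoduleCont_le N)
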